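/- Let $0<a<b$, let $D_r\subset\mathbb R^2$ be the closed disc of radius $r$ centred at the origin, and let $1/(2b)<\lambda\le 1/b$. Let $\Omega$ be an optimal polygon, i.e. a convex polygon that minimizes $\lambda|K|-P(K)$ ($|K|$ the area, $P(K)$ the perimeter) among all convex sets $K$ with $D_a\subseteq K\subseteq D_b$. Let $p$ be the number of tangent-chord angles of $\Omega$, that is, half the number of segments $VT$ contained in a side of $\Omega$, where $V$ is an endpoint of the side lying on $\partial D_b$ and $T$ is the point at which the side is tangent to $D_a$ (a side that is a chord of $D_b$ tangent to $D_a$ thus counts once). Let $q$ be the number of chord angles of $\Omega$, that is, the number of sides that are chords of $D_b$ not tangent to $D_a$; the chord angle of such a side is half the angle it subtends at the origin. Let $\xi_0,x_0,x_1\in(0,\pi/2]$ be given by $\cos\xi_0=a/b$, $\cos x_0=\frac1{2\lambda b}$, $\cos x_1=\frac1{\lambda b}-1$, and let $p_0=\lfloor \pi/\xi_0\rfloor$. Then $$p_0+1-p\le q\le \frac{\pi}{x_0}-p\,\frac{\xi_0}{x_0}+1,$$ where the left inequality is asserted when $p\,\xi_0\neq\pi$; if $p\,\xi_0=\pi$,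 then $p=p_0$ and $q=0$. If moreover two distinct values occur among the chord angles of $\Omega$, then $(\pi-p\xi_0)^2\ge\frac92x_1$ and $$\frac{\pi-p\xi_0+\sqrt{(\pi-p\xi_0)^2-\frac92x_1}}{2x_1}+1\;\le\; q\;\le\;\frac{\pi}{x_1}-p\,\frac{\xi_0}{x_1}+1 .$$ -/

import Mathlib

namespace RingProblem

open MeasureTheory

/-- The Euclidean plane. -/
abbrev Plane : Type := EuclideanSpace ℝ (Fin 2)

/-- The admissible class: convex sets lying between the concentric discs of radii `a` and `b`. -/
def admissible (a b : ℝ) : Set (Set Plane) :=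
  {K | Convex ℝ K ∧ Metric.closedBall 0 a ⊆ K ∧ K ⊆ Metric.closedBall 0 b}

/-- The area of a plane set. -/
noncomputable def area (K : Set Plane) : ℝ := (volume K).toReal

/-- The perimeter of a plane convex set: the length (one-dimensional Hausdorff measure) of its
boundary. -/
noncomputable def perimeter (K : Set Plane) : ℝ :=
  (Measure.hausdorffMeasure 1 (frontier K)).toReal

/-- The functional `lam * area - perimeter`. -/
noncomputable def J (lam : ℝ) (K : Set Plane) : ℝ := lam * area K - perimeter K

/-- `Ω` minimizes `J lam` in the admissible class. -/
def IsOptimal (a b lam : ℝ) (Ω : Set Plane) : Prop :=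
  Ω ∈ admissible a b ∧ ∀ K ∈ admissible a b, J lam Ω ≤ J lam K

/-- Convex polygons (degenerate ones are never admissible, as admissible sets contain a disc). -/
def IsConvexPolygon (Ω : Set Plane) : Prop :=
  ∃ S : Set Plane, S.Finite ∧ Ω = convexHull ℝ S

/-- `P` and `Q` are the endpoints of a side of the convex polygon `Ω`: two distinct vertices joined
by a segment of the boundary. -/
def IsSide (Ω : Set Plane) (P Q : Plane) : Prop :=
  P ∈ Ω.extremePoints ℝ ∧ Q ∈ Ω.extremePoints ℝ ∧ P ≠ Q ∧ segment ℝ P Q ⊆ frontier Ω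

/-- The segment `PQ` is tangent to the disc of radius `a` centred at the origin, at its point `T`. -/
def TouchesAt (a : ℝ) (P Q T : Plane) : Prop :=
  T ∈ segment ℝ P Q ∧
    (EuclideanGeometry.Sphere.mk (0 : Plane) a).IsTangentAt T line[ℝ, P, Q]

/-- The segments `PT` contained in a side of `Ω`, with `P` a vertex on the outer circle and `T` the
point where the side touches the inner disc. They are counted in couples: a side which is a chord
of the outer disc tangent to the inner disc consists of two of them. -/
def tangentHalfChords (a b : ℝ) (Ω : Set Plane) : Set (Set Plane) :=
  {s | ∃ P Q T, IsSide Ω P Q ∧ ‖P‖ = b ∧ TouchesAt a P Q T ∧ s = segment ℝ P T}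

/-- The number `p` of tangent-chord angles: the number of couples of segments `PT` as above. (Real
valued, so that halving involves no rounding.) -/
noncomputable def numTangentChordAngles (a b : ℝ) (Ω : Set Plane) : ℝ :=
  ((tangentHalfChords a b Ω).ncard : ℝ) / 2

/-- `PQ` is a side of `Ω` which is a chord of the outer disc and is not tangent to the inner one. -/
def IsChordSide (a b : ℝ) (Ω : Set Plane) (P Q : Plane) : Prop :=
  IsSide Ω P Q ∧ ‖P‖ = b ∧ ‖Q‖ = b ∧ ¬ ∃ T, TouchesAt a P Q T

/-- The class of sides of `Ω` that are chords of the outer disc not tangent to the inner disc. -/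
def chordSides (a b : ℝ) (Ω : Set Plane) : Set (Set Plane) :=
  {s | ∃ P Q, IsChordSide a b Ω P Q ∧ s = segment ℝ P Q}

/-- The number `q` of chord angles, counted with multiplicity: one for each chord side. -/
noncomputable def numChordAngles (a b : ℝ) (Ω : Set Plane) : ℕ :=
  (chordSides a b Ω).ncard

/-- The values of the chord angles: for a chord side `PQ`, the angle at the origin between `P` and
the midpoint of `PQ`. -/
noncomputable def chordAngles (a b : ℝ) (Ω : Set Plane) : Set ℝ :=
  {η | ∃ P Q, IsChordSide a b Ω P Q ∧ η = InnerProductGeometry.angle P (midpoint ℝ P Q)}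

/-- The angle `ξ₀` in `(0, π/2)` with `cos ξ₀ = a / b`. -/
noncomputable def xi0 (a b : ℝ) : ℝ := Real.arccos (a / b)

/-- The integer part `p₀` of `π / ξ₀`. -/
noncomputable def p0 (a b : ℝ) : ℕ := ⌊Real.pi / xi0 a b⌋₊

/-- The angle `x₀` with `cos x₀ = 1 / (2 lam b)`. -/
noncomputable def x0 (b lam : ℝ) : ℝ := Real.arccos (1 / (2 * lam * b))

/-- The angle `x₁` with `cos x₁ = 1 / (lam b) - 1`. -/
noncomputable def x1 (b lam : ℝ) : ℝ := Real.arccos (1 / (lam * b) - 1)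

end RingProblem

namespace RingProblem

open MeasureTheory Filter Topology

/-! Write `J` as a sum over the sides. The proof reduces the problem to one about finitely many
angles.

All vertices lie on the outer circle (`norm_vertex_eq`). At a vertex strictly inside, suppose one
side misses the inner disc, and slide the vertex along the line of the other side. The area is
affine in the displacement and the perimeter is convex, strictly because of the first side. So `J`
is strictly concave along the motion and has no minimum at its midpoint. Hence both sides touch the
inner disc, and the vertex spans a kite between its two points of contact. A chord of the outer
circle with the same angle at the origin contributes strictly less than the kite when `lam ≤ 1 / b`
(`chordJ_lt_kiteJ`). The half sides left over pair up into tangent chords, so the chords close up to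
an inscribed polygon, which does better than `Ω`.

What remains is to minimize the sum of `chordJ` over half-angles in `(0, ξ₀]` with sum `π`. Here `p`
counts the angles equal to `ξ₀` and `q` the smaller, free ones. Bounding each free angle by `ξ₀`
gives the lower estimate of `q`. Since `chordJ` is strictly concave on `(0, x₀)`, at most one free
angle is below `x₀`, which gives the upper estimate.

If free angles `α < β` occur, stationarity gives `lam * b * (cos α + cos β) = 1`, so `α < x₀ < β`.
Then `α` occurs once and all other free angles equal `β`. Averaging `β` with an angle `ξ₀` would
lower the sum, so `p = 0` and `α + N β = π` with `N = q - 1`. The second variation gives `N sin α ≤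
sin β`. Elementary estimates of cosines turn these relations into `N x₁ ≤ π` and a quadratic
inequality for `N` (`two_angle_bounds`). -/

/-! ### Orientation and area of triangles -/

/-- The determinant of two plane vectors. -/
def cross (x y : Plane) : ℝ := x 0 * y 1 - x 1 * y 0

/-- Twice the signed area of the triangle `A B C`. -/
def orient (A B C : Plane) : ℝ := (B 0 - A 0) * (C 1 - A 1) - (B 1 - A 1) * (C 0 - A 0)

lemma plane_ext {x y : Plane} (h0 : x 0 = y 0) (h1 : x 1 = y 1) : x = y := by
  ext i; fin_cases i <;> assumption

lemma norm_sq_plane (x : Plane) : ‖x‖ ^ 2 = x 0 ^ 2 + x 1 ^ 2 := by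
  rw [EuclideanSpace.real_norm_sq_eq, Fin.sum_univ_two]

lemma inner_plane (x y : Plane) : inner ℝ x y = x 0 * y 0 + x 1 * y 1 := by
  simp [PiLp.inner_apply, Fin.sum_univ_two, mul_comm]

lemma orient_rotate (A B C : Plane) : orient A B C = orient B C A := by
  unfold orient; ring

lemma orient_eq_cross (A B C : Plane) :
    orient A B C = cross A B + cross B C - cross A C := by
  unfold orient cross; ring

lemma orient_affine (A B C D : Plane) {s t : ℝ} (h : s + t = 1) :
    orient A B (s • C + t • D) = s * orient A B C + t * orient A B D := by
  obtain rfl : s = 1 - t := by linarith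
  simp [orient]; ring

lemma continuous_coord (i : Fin 2) : Continuous fun x : Plane => x i := by fun_prop

lemma continuous_orient (A B : Plane) : Continuous (orient A B) := by
  unfold orient; fun_prop

/-- The standard triangle. -/
def stdTri : Set Plane := {s | 0 ≤ s 0 ∧ 0 ≤ s 1 ∧ s 0 + s 1 ≤ 1}

lemma volume_stdTri : volume stdTri = ENNReal.ofReal (1 / 2) := by
  let e := (MeasurableEquiv.toLp 2 (Fin 2 → ℝ)).symm.trans (MeasurableEquiv.finTwoArrow (α := ℝ))
  have he : MeasurePreserving e volume volume :=
    (volume_preserving_finTwoArrow ℝ).comp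
      (EuclideanSpace.volume_preserving_symm_measurableEquiv_toLp (Fin 2))
  let T : Set (ℝ × ℝ) := {p | 0 ≤ p.1 ∧ 0 ≤ p.2 ∧ p.1 + p.2 ≤ 1}
  have hT : stdTri = e ⁻¹' T := rfl
  have hTm : MeasurableSet T := by
    apply IsClosed.measurableSet
    exact (isClosed_le continuous_const continuous_fst).inter
      ((isClosed_le continuous_const continuous_snd).inter
        (isClosed_le (continuous_fst.add continuous_snd) continuous_const))
  rw [hT, he.measure_preimage_equiv, Measure.volume_eq_prod, Measure.prod_apply hTm]
  have h1 : ∀ x : ℝ, volume (Prod.mk x ⁻¹' T) =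
      (Set.Icc (0 : ℝ) 1).indicator (fun x => ENNReal.ofReal (1 - x)) x := by
    intro x
    by_cases hx : x ∈ Set.Icc (0 : ℝ) 1
    · rw [Set.indicator_of_mem hx]
      have : Prod.mk x ⁻¹' T = Set.Icc 0 (1 - x) := by
        ext y; simp only [T, Set.mem_preimage, Set.mem_ofPred_eq, Set.mem_Icc]
        exact ⟨fun h => ⟨h.2.1, by linarith [h.2.2]⟩, fun h => ⟨hx.1, h.1, by linarith [h.2]⟩⟩
      rw [this, Real.volume_Icc]; simp
    · rw [Set.indicator_of_notMem hx]
      have : Prod.mk x ⁻¹' T = ∅ := by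
        ext y; simp only [T, Set.mem_preimage, Set.mem_ofPred_eq, Set.mem_empty_iff_false, iff_false]
        intro h; exact hx ⟨h.1, by linarith [h.2.1, h.2.2]⟩
      rw [this, measure_empty]
  simp_rw [h1]
  rw [lintegral_indicator measurableSet_Icc, ← ofReal_integral_eq_lintegral_ofReal]
  · congr 1
    rw [integral_Icc_eq_integral_Ioc, ← intervalIntegral.integral_of_le zero_le_one]
    rw [intervalIntegral.integral_sub (by simp) (by simp)]
    simp; norm_num
  · exact (continuous_const.sub continuous_id).continuousOn.integrableOn_Icc
  · filter_upwards [ae_restrict_mem measurableSet_Icc] with x hx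
    simpa using hx.2

/-- The (possibly degenerate) triangle with vertices `A`, `B`, `C`. -/
def tri (A B C : Plane) : Set Plane :=
  (fun s : Plane => A + (s 0 • (B - A) + s 1 • (C - A))) '' stdTri

lemma volume_tri (A B C : Plane) : volume (tri A B C) = ENNReal.ofReal (|orient A B C| / 2) := by
  let b := (EuclideanSpace.basisFun (Fin 2) ℝ).toBasis
  let L : Plane →ₗ[ℝ] Plane := Matrix.toLin b b
    !![(B - A) 0, (C - A) 0; (B - A) 1, (C - A) 1]
  have hL : ∀ s, L s = s 0 • (B - A) + s 1 • (C - A) := by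
    intro s
    apply plane_ext <;>
      simp [L, b, Matrix.toLin_apply, Matrix.mulVec, dotProduct, Fin.sum_univ_two] <;> ring
  have hdet : LinearMap.det L = orient A B C := by
    simp [L, LinearMap.det_toLin, Matrix.det_fin_two, orient]; ring
  have : tri A B C = (fun x => A + x) '' (L '' stdTri) := by
    rw [Set.image_image]; simp only [hL]; rfl
  rw [this, Set.image_add_left, measure_preimage_add, Measure.addHaar_image_linearMap, hdet, volume_stdTri,
    ← ENNReal.ofReal_mul (abs_nonneg _)]
  congr 1; ring

lemma isCompact_stdTri : IsCompact stdTri := by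
  apply Metric.isCompact_of_isClosed_isBounded
  · exact (isClosed_le continuous_const (continuous_coord 0)).inter
      ((isClosed_le continuous_const (continuous_coord 1)).inter
        (isClosed_le ((continuous_coord 0).add (continuous_coord 1)) continuous_const))
  · rw [isBounded_iff_forall_norm_le]
    refine ⟨1, fun x hx => ?_⟩
    obtain ⟨h0, h1, h2⟩ := hx
    have := norm_sq_plane x
    nlinarith [norm_nonneg x, mul_nonneg h0 h1]

lemma measurableSet_tri (A B C : Plane) : MeasurableSet (tri A B C) :=
  (isCompact_stdTri.image (by fun_prop)).measurableSet

lemma tri_subset {A B C : Plane} {K : Set Plane} (hK : Convex ℝ K) (hA : A ∈ K) (hB : B ∈ K)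
    (hC : C ∈ K) : tri A B C ⊆ K := by
  rintro _ ⟨s, ⟨h0, h1, h2⟩, rfl⟩
  have := hK.sum_mem (t := Finset.univ) (w := ![1 - s 0 - s 1, s 0, s 1]) (z := ![A, B, C])
    (by intro i _; fin_cases i <;> simp <;> linarith)
    (by simp [Fin.sum_univ_three]; ring)
    (by intro i _; fin_cases i <;> simpa)
  convert! this using 1
  apply plane_ext <;> simp [Fin.sum_univ_three] <;> ring

lemma mem_tri {A B C x : Plane} (h : 0 < orient A B C) (h1 : 0 ≤ orient A B x)
    (h2 : 0 ≤ orient B C x) (h3 : orient A C x ≤ 0) : x ∈ tri A B C := by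
  -- Barycentric coordinates as quotients of signed areas; the third one is `orient B C x / orient A
  -- B C`.
  refine ⟨WithLp.toLp 2 ![-orient A C x / orient A B C, orient A B x / orient A B C],
    ⟨?_, ?_, ?_⟩, ?_⟩
  · simpa using div_nonneg (neg_nonneg.2 h3) h.le
  · simpa using div_nonneg h1 h.le
  · have : orient B C x = orient A B C - orient A B x + orient A C x := by unfold orient; ring
    simp only [Matrix.cons_val_zero, Matrix.cons_val_one]
    rw [← add_div, div_le_one h]; linarith
  · have hne := h.ne'
    apply plane_ext <;> simp <;> field_simp <;> simp only [orient] <;> ring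

lemma orient_tri {A B C x : Plane} (h : 0 ≤ orient A B C) (hx : x ∈ tri A B C) :
    0 ≤ orient A B x ∧ 0 ≤ orient B C x ∧ orient A C x ≤ 0 := by
  obtain ⟨s, ⟨h0, h1, h2⟩, rfl⟩ := hx
  refine ⟨?_, ?_, ?_⟩
  · have : orient A B (A + (s 0 • (B - A) + s 1 • (C - A))) = s 1 * orient A B C := by
      simp [orient]; ring
    rw [this]; positivity
  · have : orient B C (A + (s 0 • (B - A) + s 1 • (C - A))) = (1 - s 0 - s 1) * orient A B C := by
      simp [orient]; ring
    rw [this]; exact mul_nonneg (by linarith) h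
  · have : orient A C (A + (s 0 • (B - A) + s 1 • (C - A))) = -(s 0 * orient A B C) := by
      simp [orient]; ring
    rw [this]; simpa using mul_nonneg h0 h

lemma volume_line {A B : Plane} (h : A ≠ B) : volume {x | orient A B x = 0} = 0 := by
  let b := (EuclideanSpace.basisFun (Fin 2) ℝ).toBasis
  let s : AffineSubspace ℝ Plane :=
    { carrier := {x | orient A B x = 0}
      smul_vsub_vadd_mem' := by
        intro c x y z hx hy hz
        simp only [Set.mem_ofPred_eq] at *
        have : orient A B (c • (x -ᵥ y) +ᵥ z) = c * (orient A B x - orient A B y) + orient A B z := by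
          simp [orient]; ring
        rw [this, hx, hy, hz]; ring }
  refine Measure.addHaar_affineSubspace volume s ?_
  intro hs
  have key : ∀ x, orient A B x = 0 := by
    intro x
    have : x ∈ s := by rw [hs]; trivial
    exact this
  apply h
  have e0 := key (A + EuclideanSpace.single 0 1)
  have e1 := key (A + EuclideanSpace.single 1 1)
  simp [orient] at e0 e1
  exact plane_ext (by linarith) (by linarith)

/-! ### Convex polygons: interior, boundary, area and perimeter -/

/-- `v 0, …, v (n - 1)`, followed by `v n = v 0`, are the vertices of a convex polygon, listed
anticlockwise. -/
structure ConvexCycle (n : ℕ) (v : ℕ → Plane) : Prop where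
  three_le : 3 ≤ n
  closed : v n = v 0
  pos : ∀ i j k, i < j → j < k → k < n → 0 < orient (v i) (v j) (v k)

/-- The convex hull of the vertices. -/
def polygon (n : ℕ) (v : ℕ → Plane) : Set Plane := convexHull ℝ (v '' Set.Iio n)

lemma orient_self_left (A C : Plane) : orient A A C = 0 := by unfold orient; ring

lemma orient_self_right (A C : Plane) : orient A C C = 0 := by unfold orient; ring

lemma orient_self_outer (A C : Plane) : orient A C A = 0 := by unfold orient; ring

lemma convex_orient_nonneg (A B : Plane) : Convex ℝ {x | 0 ≤ orient A B x} := by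
  intro x hx y hy s t hs ht hst
  simp only [Set.mem_ofPred_eq] at *
  rw [orient_affine _ _ _ _ hst]; positivity

namespace ConvexCycle

variable {n : ℕ} {v : ℕ → Plane} (h : ConvexCycle n v)

include h

lemma apply_mod {k : ℕ} (hk : k ≤ n) : v (k % n) = v k := by
  rcases hk.lt_or_eq with hk | rfl
  · rw [Nat.mod_eq_of_lt hk]
  · rw [Nat.mod_self, h.closed]

lemma pos_n : 0 < n := by have := h.three_le; omega

lemma orient_side_pos {k j : ℕ} (hk : k < n) (hj : j < n) (h1 : j ≠ k) (h2 : j ≠ (k + 1) % n) :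
    0 < orient (v k) (v (k + 1)) (v j) := by
  by_cases hk1 : k + 1 < n
  · rw [Nat.mod_eq_of_lt hk1] at h2
    rcases lt_or_gt_of_ne h1 with hjk | hjk
    · rw [← orient_rotate]; exact h.pos _ _ _ hjk (Nat.lt_succ_self k) hk1
    · exact h.pos _ _ _ (Nat.lt_succ_self k) (by omega) hj
  · obtain rfl : n = k + 1 := by omega
    rw [Nat.mod_self] at h2
    rw [h.closed, orient_rotate]
    exact h.pos _ _ _ (by omega) (by omega) hk

lemma orient_side_nonneg {k j : ℕ} (hk : k < n) (hj : j < n) :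
    0 ≤ orient (v k) (v (k + 1)) (v j) := by
  by_cases h1 : j = k
  · rw [h1, orient_self_outer]
  by_cases h2 : j = (k + 1) % n
  · rw [h2, h.apply_mod hk, orient_self_right]
  exact (h.orient_side_pos hk hj h1 h2).le

lemma succ_mod_ne {k : ℕ} (hk : k < n) : (k + 1) % n ≠ k := by
  have := h.three_le
  by_cases hk1 : k + 1 < n
  · rw [Nat.mod_eq_of_lt hk1]; omega
  · obtain rfl : n = k + 1 := by omega
    rw [Nat.mod_self]; omega

lemma exists_other (k : ℕ) : ∃ m < n, m ≠ k ∧ m ≠ (k + 1) % n := by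
  have h3 := h.three_le
  by_contra! hc
  have h0 := hc 0 (by omega)
  have h1 := hc 1 (by omega)
  have h2 := hc 2 (by omega)
  omega

lemma apply_succ_ne {k : ℕ} (hk : k < n) : v (k + 1) ≠ v k := by
  obtain ⟨m, hm, h1, h2⟩ := h.exists_other k
  intro he
  have := h.orient_side_pos hk hm h1 h2
  rw [he, orient_self_left] at this
  exact lt_irrefl _ this

lemma injOn : Set.InjOn v (Set.Iio n) := by
  intro i hi j hj hij
  by_contra hne
  by_cases h2 : j = (i + 1) % n
  · apply h.apply_succ_ne hi
    rw [hij, h2, h.apply_mod hi]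
  · have := h.orient_side_pos hi hj (Ne.symm hne) h2
    rw [hij, orient_self_outer] at this
    exact lt_irrefl _ this

lemma mem_polygon {k : ℕ} (hk : k ≤ n) : v k ∈ polygon n v := by
  rw [← h.apply_mod hk]
  exact subset_convexHull _ _ ⟨_, Nat.mod_lt _ h.pos_n, rfl⟩

omit h in
lemma convex_polygon (n : ℕ) (v : ℕ → Plane) : Convex ℝ (polygon n v) := convex_convexHull _ _

lemma side_subset {k : ℕ} (hk : k < n) : segment ℝ (v k) (v (k + 1)) ⊆ polygon n v :=
  (convex_polygon n v).segment_subset (h.mem_polygon hk.le) (h.mem_polygon hk)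

lemma orient_nonneg_of_mem {x : Plane} (hx : x ∈ polygon n v) {k : ℕ} (hk : k < n) :
    0 ≤ orient (v k) (v (k + 1)) x := by
  refine convexHull_min ?_ (convex_orient_nonneg (v k) (v (k + 1))) hx
  rintro _ ⟨j, hj, rfl⟩
  exact h.orient_side_nonneg hk hj

/-- A point on the inner side of all sides lies in one of the triangles of the fan at `v 0`. -/
lemma exists_mem_tri {x : Plane} (hx : ∀ k < n, 0 ≤ orient (v k) (v (k + 1)) x) :
    ∃ k < n - 2, x ∈ tri (v 0) (v (k + 1)) (v (k + 2)) := by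
  have h3 := h.three_le
  have hlast : orient (v 0) (v (n - 2 + 1)) x ≤ 0 := by
    have := hx (n - 1) (by omega)
    rw [show n - 1 + 1 = n by omega, h.closed] at this
    rw [show n - 2 + 1 = n - 1 by omega]
    have e : orient (v 0) (v (n - 1)) x = -orient (v (n - 1)) (v 0) x := by unfold orient; ring
    linarith
  have hex : ∃ m, orient (v 0) (v (m + 2)) x ≤ 0 := ⟨n - 3, by
    rwa [show n - 3 + 2 = n - 2 + 1 by omega]⟩
  classical
  let m := Nat.find hex
  have hm : orient (v 0) (v (m + 2)) x ≤ 0 := Nat.find_spec hex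
  have hmn : m ≤ n - 3 := Nat.find_min' hex (by rwa [show n - 3 + 2 = n - 2 + 1 by omega])
  have hm0 : 0 ≤ orient (v 0) (v (m + 1)) x := by
    rcases Nat.eq_zero_or_pos m with h0 | h0
    · rw [h0]; exact hx 0 (by omega)
    · have := Nat.find_min hex (m := m - 1) (by omega)
      rw [show m - 1 + 2 = m + 1 by omega] at this
      exact (not_le.1 this).le
  exact ⟨m, by omega, mem_tri (h.pos _ _ _ (by omega) (by omega) (by omega)) hm0
    (hx (m + 1) (by omega)) hm⟩

lemma tri_subset_polygon {k : ℕ} (hk : k < n - 2) :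
    tri (v 0) (v (k + 1)) (v (k + 2)) ⊆ polygon n v :=
  tri_subset (convex_polygon n v) (h.mem_polygon (by omega)) (h.mem_polygon (by omega))
    (h.mem_polygon (by omega))

lemma mem_polygon_iff {x : Plane} :
    x ∈ polygon n v ↔ ∀ k < n, 0 ≤ orient (v k) (v (k + 1)) x := by
  refine ⟨fun hx k hk => h.orient_nonneg_of_mem hx hk, fun hx => ?_⟩
  obtain ⟨k, hk, hxk⟩ := h.exists_mem_tri hx
  exact h.tri_subset_polygon hk hxk

lemma polygon_eq_biUnion_tri :
    polygon n v = ⋃ k ∈ Finset.range (n - 2), tri (v 0) (v (k + 1)) (v (k + 2)) := by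
  ext x
  simp only [Set.mem_iUnion, Finset.mem_range, exists_prop]
  exact ⟨fun hx => h.exists_mem_tri fun k hk => h.orient_nonneg_of_mem hx hk,
    fun ⟨k, hk, hx⟩ => h.tri_subset_polygon hk hx⟩

/-- The diagonal from `v 0` to `v (j + 2)` separates the two triangles of the fan, so a common point
lies on its line. -/
lemma aedisjoint_tri {j k : ℕ} (hjk : j < k) (hk : k < n - 2) :
    AEDisjoint volume (tri (v 0) (v (j + 1)) (v (j + 2))) (tri (v 0) (v (k + 1)) (v (k + 2))) := by
  have hne : v 0 ≠ v (j + 2) := fun he => by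
    have := h.injOn (Set.mem_Iio.2 (by omega)) (Set.mem_Iio.2 (by omega)) he
    omega
  refine measure_mono_null ?_ (volume_line hne)
  rintro x ⟨hx, hx'⟩
  obtain ⟨-, -, a3⟩ := orient_tri (h.pos _ _ _ (by omega) (by omega) (by omega)).le hx
  obtain ⟨b1, -, -⟩ := orient_tri (h.pos _ _ _ (by omega) (by omega) (by omega)).le hx'
  show orient (v 0) (v (j + 2)) x = 0
  rcases Nat.eq_or_lt_of_le (show j + 2 ≤ k + 1 by omega) with he | hlt
  · rw [← he] at b1; exact le_antisymm a3 b1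
  have hp := h.orient_nonneg_of_mem (h.tri_subset_polygon hk hx') h.pos_n
  rw [Nat.zero_add] at hp
  have pu := h.pos 0 1 (j + 2) (by omega) (by omega) (by omega)
  have pw := h.pos 0 1 (k + 1) (by omega) (by omega) (by omega)
  have uw := h.pos 0 (j + 2) (k + 1) (by omega) hlt (by omega)
  -- Plücker relation for the vectors from `v 0` to `v 1`, `v (j + 2)`, `v (k + 1)` and `x`.
  have key : orient (v 0) (v 1) (v (j + 2)) * orient (v 0) (v (k + 1)) x
      - orient (v 0) (v 1) (v (k + 1)) * orient (v 0) (v (j + 2)) x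
      + orient (v 0) (v 1) x * orient (v 0) (v (j + 2)) (v (k + 1)) = 0 := by
    unfold orient; ring
  have e1 := mul_nonneg pu.le b1
  have e2 := mul_nonneg hp uw.le
  have e3 : 0 ≤ orient (v 0) (v 1) (v (k + 1)) * orient (v 0) (v (j + 2)) x := by linarith
  exact le_antisymm a3 (nonneg_of_mul_nonneg_right e3 pw)

lemma area_polygon : area (polygon n v) = (∑ k ∈ Finset.range n, cross (v k) (v (k + 1))) / 2 := by
  have h3 := h.three_le
  have h1 : volume (polygon n v) =
      ∑ k ∈ Finset.range (n - 2), volume (tri (v 0) (v (k + 1)) (v (k + 2))) := by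
    rw [h.polygon_eq_biUnion_tri]
    apply measure_biUnion_finset₀
    · intro j hj k hk hjk
      simp only [Finset.coe_range, Set.mem_Iio] at hj hk
      rcases lt_or_gt_of_ne hjk with hlt | hlt
      · exact h.aedisjoint_tri hlt hk
      · exact (h.aedisjoint_tri hlt hj).symm
    · intro k _; exact (measurableSet_tri _ _ _).nullMeasurableSet
  have h2 : ∀ k ∈ Finset.range (n - 2), (volume (tri (v 0) (v (k + 1)) (v (k + 2)))).toReal =
      orient (v 0) (v (k + 1)) (v (k + 2)) / 2 := by
    intro k hk
    rw [Finset.mem_range] at hk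
    have := h.pos 0 (k + 1) (k + 2) (by omega) (by omega) (by omega)
    rw [volume_tri, abs_of_pos this, ENNReal.toReal_ofReal (by positivity)]
  rw [area, h1, ENNReal.toReal_sum (fun k _ => by rw [volume_tri]; exact ENNReal.ofReal_ne_top),
    Finset.sum_congr rfl h2, ← Finset.sum_div]
  congr 1
  -- From the fan at `v 0` to the shoelace formula: the two sums differ by a telescoping sum around
  -- the closed cycle. The fan over all sides has two extra triangles, the first and the last, which
  -- are degenerate.
  have h4 : ∑ k ∈ Finset.range n, orient (v 0) (v k) (v (k + 1)) =
      ∑ k ∈ Finset.range n, cross (v k) (v (k + 1)) := by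
    simp_rw [orient_eq_cross]
    have := Finset.sum_range_sub' (fun k => cross (v 0) (v k)) n
    rw [h.closed, sub_self] at this
    rw [← sub_eq_zero, ← Finset.sum_sub_distrib, ← this]
    exact Finset.sum_congr rfl fun k _ => by ring
  rw [← h4]
  obtain ⟨m, rfl⟩ : ∃ m, n = m + 2 := ⟨n - 2, by omega⟩
  rw [Finset.sum_range_succ, h.closed, orient_self_outer, Finset.sum_range_succ', orient_self_left,
    Nat.add_sub_cancel]
  simp

omit h in
lemma orient_eq_zero_of_mem_segment {A B x : Plane} (hx : x ∈ segment ℝ A B) :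
    orient A B x = 0 := by
  obtain ⟨s, t, -, -, hst, rfl⟩ := hx
  rw [orient_affine _ _ _ _ hst, orient_self_outer, orient_self_right]; simp

/-- The line through a side does not contain both ends of another side. -/
lemma orient_side_pos_or {j k : ℕ} (hj : j < n) (hk : k < n) (hjk : j ≠ k) :
    0 < orient (v j) (v (j + 1)) (v k) ∨ 0 < orient (v j) (v (j + 1)) (v (k + 1)) := by
  have h3 := h.three_le
  by_cases h2 : k = (j + 1) % n
  · right
    rw [← h.apply_mod hk]
    apply h.orient_side_pos hj (Nat.mod_lt _ h.pos_n)
    · by_cases hj1 : j + 1 < n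
      · rw [Nat.mod_eq_of_lt hj1] at h2
        by_cases hk1 : k + 1 < n
        · rw [Nat.mod_eq_of_lt hk1]; omega
        · rw [show k.succ = n by omega, Nat.mod_self]; omega
      · rw [show j + 1 = n by omega, Nat.mod_self] at h2
        rw [Nat.mod_eq_of_lt (by omega)]; omega
    · rw [← h2]; exact h.succ_mod_ne hk
  · left; exact h.orient_side_pos hj hk (Ne.symm hjk) h2

/-- The points strictly to the left of the line, together with those of the side itself, form a
convex set containing all the vertices. -/
lemma mem_side_of_orient_eq_zero {x : Plane} (hx : x ∈ polygon n v) {k : ℕ} (hk : k < n)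
    (h0 : orient (v k) (v (k + 1)) x = 0) : x ∈ segment ℝ (v k) (v (k + 1)) := by
  have key : ∀ y ∈ polygon n v, 0 < orient (v k) (v (k + 1)) y ∨
      y ∈ segment ℝ (v k) (v (k + 1)) := by
    intro y hy
    have hconv : Convex ℝ {y | 0 < orient (v k) (v (k + 1)) y ∨
        y ∈ segment ℝ (v k) (v (k + 1))} := by
      intro y hy z hz s t hs ht hst
      rcases hs.eq_or_lt with rfl | hs
      · obtain rfl : t = 1 := by linarith
        simpa using hz
      rcases ht.eq_or_lt with rfl | ht
      · obtain rfl : s = 1 := by linarith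
        simpa using hy
      rcases hy with hy | hy <;> rcases hz with hz | hz
      · left; rw [orient_affine _ _ _ _ hst]; positivity
      · left; rw [orient_affine _ _ _ _ hst, orient_eq_zero_of_mem_segment hz]
        simpa using mul_pos hs hy
      · left; rw [orient_affine _ _ _ _ hst, orient_eq_zero_of_mem_segment hy]
        simpa using mul_pos ht hz
      · right; exact convex_segment _ _ hy hz hs.le ht.le hst
    refine convexHull_min ?_ hconv hy
    rintro _ ⟨j, hj, rfl⟩
    by_cases h1 : j = k
    · right; rw [h1]; exact left_mem_segment _ _ _
    by_cases h2 : j = (k + 1) % n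
    · right; rw [h2, h.apply_mod hk]; exact right_mem_segment _ _ _
    · left; exact h.orient_side_pos hk hj h1 h2
  rcases key x hx with hpos | hseg
  · linarith
  · exact hseg

omit h in
lemma isClosed_polygon (n : ℕ) (v : ℕ → Plane) : IsClosed (polygon n v) :=
  ((Set.finite_Iio n).image v).isClosed_convexHull ℝ

lemma mem_interior_iff {x : Plane} :
    x ∈ interior (polygon n v) ↔ ∀ k < n, 0 < orient (v k) (v (k + 1)) x := by
  constructor
  · intro hx k hk
    have hx' := interior_subset hx
    refine lt_of_le_of_ne (h.orient_nonneg_of_mem hx' hk) fun h0 => ?_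
    obtain ⟨m, hm, h1, h2⟩ := h.exists_other k
    have hpos := h.orient_side_pos hk hm h1 h2
    -- An interior point on the line of side `k` could be pushed away from the vertex `v m`, which
    -- is off that line, and would leave the half-plane.
    have hlim : Tendsto (fun t : ℝ => x + t • (x - v m)) (𝓝[>] 0) (𝓝 x) := by
      have : Continuous (fun t : ℝ => x + t • (x - v m)) := by fun_prop
      simpa using (this.tendsto 0).mono_left nhdsWithin_le_nhds
    have hev := hlim.eventually (mem_interior_iff_mem_nhds.1 hx)
    obtain ⟨t, ht, ht0⟩ := (hev.and self_mem_nhdsWithin).exists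
    have := h.orient_nonneg_of_mem ht hk
    have e : orient (v k) (v (k + 1)) (x + t • (x - v m)) =
        (1 + t) * orient (v k) (v (k + 1)) x - t * orient (v k) (v (k + 1)) (v m) := by
      simp [orient]; ring
    rw [e, ← h0] at this
    have := mul_pos (Set.mem_Ioi.1 ht0) hpos
    linarith
  · intro hx
    have ho : IsOpen {y | ∀ k < n, 0 < orient (v k) (v (k + 1)) y} := by
      have : {y | ∀ k < n, 0 < orient (v k) (v (k + 1)) y} =
          ⋂ k ∈ Set.Iio n, {y | 0 < orient (v k) (v (k + 1)) y} := by ext; simp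
      rw [this]
      exact (Set.finite_Iio n).isOpen_biInter fun k _ =>
        isOpen_lt continuous_const (continuous_orient _ _)
    refine interior_maximal ?_ ho hx
    intro y hy
    exact h.mem_polygon_iff.2 fun k hk => (hy k hk).le

lemma frontier_polygon :
    frontier (polygon n v) = ⋃ k ∈ Finset.range n, segment ℝ (v k) (v (k + 1)) := by
  ext x
  rw [(isClosed_polygon n v).frontier_eq, Set.mem_sdiff, h.mem_interior_iff]
  simp only [Set.mem_iUnion, Finset.mem_range, exists_prop, not_forall, not_lt]
  constructor
  · rintro ⟨hx, k, hk, hle⟩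
    exact ⟨k, hk, h.mem_side_of_orient_eq_zero hx hk
      (le_antisymm hle (h.orient_nonneg_of_mem hx hk))⟩
  · rintro ⟨k, hk, hx⟩
    exact ⟨h.side_subset hk hx, k, hk, (orient_eq_zero_of_mem_segment hx).le⟩

/-- On side `k` the orientation with respect to side `j` is affine, nonnegative, and positive at one
end, so it can vanish only at the other. The perimeter formula needs only that the intersection is
finite, hence null. -/
lemma side_inter_subset {j k : ℕ} (hj : j < n) (hk : k < n) (hjk : j ≠ k) :
    segment ℝ (v j) (v (j + 1)) ∩ segment ℝ (v k) (v (k + 1)) ⊆ {v k, v (k + 1)} := by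
  rintro x ⟨hxj, s, t, hs, ht, hst, rfl⟩
  have e := orient_eq_zero_of_mem_segment hxj
  rw [orient_affine _ _ _ _ hst] at e
  have a1 := h.orient_nonneg_of_mem (h.mem_polygon hk.le) hj
  have a2 := h.orient_nonneg_of_mem (h.mem_polygon hk) hj
  rcases h.orient_side_pos_or hj hk hjk with hp | hp
  · have : s = 0 := by
      by_contra hs0
      have := mul_pos (lt_of_le_of_ne hs (Ne.symm hs0)) hp
      have := mul_nonneg ht a2
      linarith
    obtain rfl : t = 1 := by linarith
    rw [this]; simp
  · have : t = 0 := by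
      by_contra hs0
      have := mul_pos (lt_of_le_of_ne ht (Ne.symm hs0)) hp
      have := mul_nonneg hs a1
      linarith
    obtain rfl : s = 1 := by linarith
    rw [this]; simp

lemma perimeter_polygon :
    perimeter (polygon n v) = ∑ k ∈ Finset.range n, ‖v (k + 1) - v k‖ := by
  have h1 : Measure.hausdorffMeasure 1 (frontier (polygon n v)) =
      ∑ k ∈ Finset.range n, (Measure.hausdorffMeasure 1 : Measure Plane)
        (segment ℝ (v k) (v (k + 1))) := by
    rw [h.frontier_polygon]
    apply measure_biUnion_finset₀
    · intro j hj k hk hjk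
      simp only [Finset.coe_range, Set.mem_Iio] at hj hk
      have := Measure.nullSingletonClass_hausdorff Plane (d := 1) one_pos
      exact measure_mono_null (h.side_inter_subset hj hk hjk)
        ((Set.toFinite {v k, v (k + 1)}).measure_zero _)
    · intro k _
      rw [← convexHull_pair]
      exact ((Set.toFinite _).isClosed_convexHull ℝ).measurableSet.nullMeasurableSet
  rw [perimeter, h1]
  simp_rw [hausdorffMeasure_segment]
  rw [ENNReal.toReal_sum (fun k _ => edist_ne_top _ _)]
  refine Finset.sum_congr rfl fun k _ => ?_
  rw [edist_comm, edist_dist, ENNReal.toReal_ofReal dist_nonneg, dist_eq_norm]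

lemma J_polygon (lam : ℝ) : J lam (polygon n v) =
    ∑ k ∈ Finset.range n, (lam / 2 * cross (v k) (v (k + 1)) - ‖v (k + 1) - v k‖) := by
  rw [J, h.area_polygon, h.perimeter_polygon, Finset.sum_sub_distrib, ← Finset.mul_sum]
  ring

end ConvexCycle

/-! ### Containing the inner disc -/

lemma orient_eq_cross_add (A B x : Plane) : orient A B x = cross A B + cross (B - A) x := by
  simp [orient, cross]; ring

lemma abs_cross_le (x y : Plane) : |cross x y| ≤ ‖x‖ * ‖y‖ := by
  refine abs_le_of_sq_le_sq ?_ (by positivity)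
  rw [mul_pow, norm_sq_plane, norm_sq_plane, cross]
  nlinarith [sq_nonneg (x 0 * y 0 + x 1 * y 1)]

/-- The foot of the perpendicular from the origin to the line `A B`, when the line is at distance
`a` from the origin, and the origin lies to its left. -/
noncomputable def foot (a : ℝ) (A B : Plane) : Plane :=
  (a / ‖B - A‖) • WithLp.toLp 2 ![(B - A) 1, -(B - A) 0]

lemma norm_foot {a : ℝ} (ha : 0 ≤ a) {A B : Plane} (h : A ≠ B) : ‖foot a A B‖ = a := by
  have hpos : 0 < ‖B - A‖ := norm_pos_iff.2 (sub_ne_zero.2 h.symm)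
  have h1 : ‖(WithLp.toLp 2 ![(B - A) 1, -(B - A) 0] : Plane)‖ = ‖B - A‖ := by
    rw [← sq_eq_sq₀ (norm_nonneg _) (norm_nonneg _), norm_sq_plane, norm_sq_plane]
    simp; ring
  rw [foot, norm_smul, h1, Real.norm_of_nonneg (by positivity)]
  field_simp

lemma orient_foot {a : ℝ} {A B : Plane} (h : A ≠ B) :
    orient A B (foot a A B) = cross A B - a * ‖B - A‖ := by
  have hpos : 0 < ‖B - A‖ := norm_pos_iff.2 (sub_ne_zero.2 h.symm)
  have e : cross (B - A) (foot a A B) = -(a / ‖B - A‖ * ‖B - A‖ ^ 2) := by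
    rw [norm_sq_plane]; simp [foot, cross]; ring
  rw [orient_eq_cross_add, e]
  field_simp; ring

lemma inner_foot (a : ℝ) (A B : Plane) : inner ℝ (foot a A B) (B - A) = 0 := by
  rw [inner_plane]; simp [foot]; ring

namespace ConvexCycle

variable {n : ℕ} {v : ℕ → Plane} (h : ConvexCycle n v)

include h

/-- The quotient of `cross (v k) (v (k + 1))` by the length of the side is the signed distance from
the origin to its line; `foot` is the point of the disc farthest out across that line. -/
lemma closedBall_subset_iff {a : ℝ} (ha : 0 ≤ a) :
    Metric.closedBall 0 a ⊆ polygon n v ↔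
      ∀ k < n, a * ‖v (k + 1) - v k‖ ≤ cross (v k) (v (k + 1)) := by
  constructor
  · intro hs k hk
    have hne := (h.apply_succ_ne hk).symm
    have := h.orient_nonneg_of_mem (hs (mem_closedBall_zero_iff.2 (norm_foot ha hne).le)) hk
    rw [orient_foot hne] at this
    linarith
  · intro hs x hx
    rw [mem_closedBall_zero_iff] at hx
    refine h.mem_polygon_iff.2 fun k hk => ?_
    have h1 := abs_cross_le (v (k + 1) - v k) x
    have h2 := neg_abs_le (cross (v (k + 1) - v k) x)
    have h3 := mul_le_mul_of_nonneg_left hx (norm_nonneg (v (k + 1) - v k))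
    have h4 := hs k hk
    rw [orient_eq_cross_add]
    linarith

lemma mem_admissible {a b : ℝ} (ha : 0 ≤ a)
    (h1 : ∀ k < n, a * ‖v (k + 1) - v k‖ ≤ cross (v k) (v (k + 1)))
    (h2 : ∀ k < n, ‖v k‖ ≤ b) : polygon n v ∈ admissible a b := by
  refine ⟨convex_polygon n v, (h.closedBall_subset_iff ha).2 h1,
    convexHull_min ?_ (convex_closedBall _ _)⟩
  rintro _ ⟨k, hk, rfl⟩
  exact mem_closedBall_zero_iff.2 (h2 k hk)

end ConvexCycle

/-! ### Vertices inside the outer disc: both sides touch the inner disc -/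

lemma cross_eq_zero_of_sameRay {x y : Plane} (h : SameRay ℝ x y) : cross x y = 0 := by
  rcases h with rfl | rfl | ⟨r, s, hr, hs, he⟩
  · simp [cross]
  · simp [cross]
  · have h0 := congrArg (fun z : Plane => z 0) he
    have h1 := congrArg (fun z : Plane => z 1) he
    simp only [PiLp.smul_apply, smul_eq_mul] at h0 h1
    have : r * cross x y = 0 := by
      unfold cross
      linear_combination y 1 * h0 - y 0 * h1
    exact (mul_eq_zero.1 this).resolve_left hr.ne'

lemma two_norm_le (x y : Plane) : 2 * ‖x‖ ≤ ‖x + y‖ + ‖x - y‖ := by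
  have := norm_add_le (x + y) (x - y)
  rw [show x + y + (x - y) = (2 : ℝ) • x by rw [two_smul]; abel, norm_smul] at this
  simpa using this

/-- Equality in the triangle inequality would make `x + y` and `x - y` parallel, hence also `x` and
`y`. This is the strict convexity of the length of a side under a motion not parallel to it. -/
lemma two_norm_lt {x y : Plane} (h : cross x y ≠ 0) : 2 * ‖x‖ < ‖x + y‖ + ‖x - y‖ := by
  have hs : ¬ SameRay ℝ (x + y) (x - y) := fun hs => by
    have := cross_eq_zero_of_sameRay hs
    apply h
    simp [cross] at this ⊢; linarith
  have := norm_add_lt_of_not_sameRay hs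
  rw [show x + y + (x - y) = (2 : ℝ) • x by rw [two_smul]; abel, norm_smul] at this
  simpa using this

/-- Moving a vertex of an optimal polygon back and forth along a line: if the constraints are
satisfied, then the lengths of the sides are affine along the movement. -/
lemma cross_eq_zero_of_movable {a b lam : ℝ} {n : ℕ} {v : ℕ → Plane} (h : ConvexCycle n v)
    (ha : 0 ≤ a) (hopt : IsOptimal a b lam (polygon n v)) (W u : Plane) (hW : ‖W‖ < b)
    (c : ℕ → Plane) (hc : ∀ k, v k = W → c k = u) (hc' : ∀ k, v k ≠ W → c k = 0)
    (hmove : ∀ k < n, ∀ᶠ t : ℝ in 𝓝 0, a * ‖v (k + 1) + t • c (k + 1) - (v k + t • c k)‖ ≤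
      cross (v k + t • c k) (v (k + 1) + t • c (k + 1))) :
    ∀ k < n, cross (v (k + 1) - v k) (c (k + 1) - c k) = 0 := by
  by_contra! hcon
  obtain ⟨m, hm, hne⟩ := hcon
  -- The motion is prescribed by the position of the vertex and not by its index, so that `v 0` and
  -- `v n` move together.
  have hcn : c n = c 0 := by
    by_cases h0 : v 0 = W
    · rw [hc 0 h0, hc n (h.closed.trans h0)]
    · rw [hc' 0 h0, hc' n (by rwa [h.closed])]
  let w : ℝ → ℕ → Plane := fun t k => v k + t • c k
  have hb : ∀ k < n, ‖v k‖ ≤ b := fun k hk => by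
    simpa using hopt.1.2.2 (h.mem_polygon hk.le)
  have hw : ∀ k, Continuous fun t => w t k := fun k => by
    show Continuous fun t : ℝ => v k + t • c k
    fun_prop
  have hw0 : ∀ k, w 0 k = v k := fun k => by simp [w]
  have e1 : ∀ᶠ t : ℝ in 𝓝 0, ∀ i ∈ Set.Iio n, ∀ j ∈ Set.Iio n, ∀ k ∈ Set.Iio n, i < j → j < k →
      0 < orient (w t i) (w t j) (w t k) := by
    rw [eventually_all_finite (Set.finite_Iio n)]; intro i hi
    rw [eventually_all_finite (Set.finite_Iio n)]; intro j hj
    rw [eventually_all_finite (Set.finite_Iio n)]; intro k hk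
    by_cases hij : i < j
    · by_cases hjk : j < k
      · have hcont : Continuous fun t => orient (w t i) (w t j) (w t k) := by
          unfold orient
          have := hw i; have := hw j; have := hw k
          fun_prop
        have hpos := h.pos i j k hij hjk hk
        have := (hcont.tendsto 0).eventually (lt_mem_nhds (a := 0) (by simpa [hw0] using hpos))
        filter_upwards [this] with t ht _ _ using ht
      · exact Eventually.of_forall fun _ _ h' => absurd h' hjk
    · exact Eventually.of_forall fun _ h' => absurd h' hij
  have e2 : ∀ᶠ t : ℝ in 𝓝 0, ∀ k ∈ Set.Iio n,
      a * ‖w t (k + 1) - w t k‖ ≤ cross (w t k) (w t (k + 1)) := by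
    rw [eventually_all_finite (Set.finite_Iio n)]; exact hmove
  have e3 : ∀ᶠ t : ℝ in 𝓝 0, ∀ k ∈ Set.Iio n, ‖w t k‖ ≤ b := by
    rw [eventually_all_finite (Set.finite_Iio n)]; intro k hk
    by_cases hk' : v k = W
    · have := ((hw k).norm.tendsto 0).eventually ((isOpen_Iio (a := b)).mem_nhds (by simpa [hw0, hk'] using hW))
      filter_upwards [this] with t ht using ht.le
    · refine Eventually.of_forall fun t => ?_
      simpa [w, hc' k hk'] using hb k hk
  have hcyc : ∀ᶠ t : ℝ in 𝓝 0, J lam (polygon n v) ≤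
      ∑ k ∈ Finset.range n, (lam / 2 * cross (w t k) (w t (k + 1)) - ‖w t (k + 1) - w t k‖) := by
    filter_upwards [e1, e2, e3] with t h1 h2 h3
    have hct : ConvexCycle n (w t) :=
      { three_le := h.three_le
        closed := by simp only [w, h.closed, hcn]
        pos := fun i j k hij hjk hk => h1 i (by simp; omega) j (by simp; omega) k hk hij hjk }
    rw [← hct.J_polygon]
    exact hopt.2 _ (hct.mem_admissible ha h2 h3)
  have hneg : ∀ᶠ t : ℝ in 𝓝 0, J lam (polygon n v) ≤
      ∑ k ∈ Finset.range n, (lam / 2 * cross (w (-t) k) (w (-t) (k + 1)) -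
        ‖w (-t) (k + 1) - w (-t) k‖) := by
    have : Tendsto (fun t : ℝ => -t) (𝓝 0) (𝓝 0) := by simpa using (continuous_neg (G := ℝ)).tendsto 0
    exact this.eventually hcyc
  obtain ⟨t, ⟨ht1, ht2⟩, ht0⟩ :=
    (((hcyc.and hneg).filter_mono nhdsWithin_le_nhds).and (self_mem_nhdsWithin (s := Set.Ioi (0:ℝ)))).exists
  have ht0 : 0 < t := ht0
  -- No two consecutive points move in different directions, so the area has no quadratic term in
  -- `t`. It cancels in the average of the motions `t` and `-t`, and only the lengths matter.
  have hcc : ∀ k, cross (c k) (c (k + 1)) = 0 := by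
    intro k
    by_cases h0 : v k = W <;> by_cases h1 : v (k + 1) = W
    · rw [hc _ h0, hc _ h1, cross]; ring
    · rw [hc' _ h1]; simp [cross]
    · rw [hc' _ h0]; simp [cross]
    · rw [hc' _ h0]; simp [cross]
  have hcross : ∀ k, cross (w t k) (w t (k + 1)) + cross (w (-t) k) (w (-t) (k + 1)) =
      2 * cross (v k) (v (k + 1)) := by
    intro k
    have := hcc k
    simp [w, cross] at this ⊢
    linear_combination 2 * t ^ 2 * this
  have hplus : ∀ k, w t (k + 1) - w t k = v (k + 1) - v k + t • (c (k + 1) - c k) := fun k => by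
    simp only [w, smul_sub]; abel
  have hminus : ∀ k, w (-t) (k + 1) - w (-t) k = v (k + 1) - v k - t • (c (k + 1) - c k) := fun k => by
    simp only [w, smul_sub, neg_smul]; abel
  have hlt : (∑ k ∈ Finset.range n, (lam / 2 * cross (w t k) (w t (k + 1)) - ‖w t (k + 1) - w t k‖)) +
      ∑ k ∈ Finset.range n, (lam / 2 * cross (w (-t) k) (w (-t) (k + 1)) -
        ‖w (-t) (k + 1) - w (-t) k‖) <
      ∑ k ∈ Finset.range n, 2 * (lam / 2 * cross (v k) (v (k + 1)) - ‖v (k + 1) - v k‖) := by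
    rw [← Finset.sum_add_distrib]
    apply Finset.sum_lt_sum
    · intro k _
      have := two_norm_le (v (k + 1) - v k) (t • (c (k + 1) - c k))
      rw [hplus, hminus]
      linear_combination this + lam / 2 * hcross k
    · refine ⟨m, Finset.mem_range.2 hm, ?_⟩
      have hne' : cross (v (m + 1) - v m) (t • (c (m + 1) - c m)) ≠ 0 := by
        have : cross (v (m + 1) - v m) (t • (c (m + 1) - c m)) =
          t * cross (v (m + 1) - v m) (c (m + 1) - c m) := by simp [cross]; ring
        rw [this]; exact mul_ne_zero ht0.ne' hne
      have := two_norm_lt hne'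
      rw [hplus, hminus]
      linear_combination this + lam / 2 * hcross m
  rw [← Finset.mul_sum, ← h.J_polygon] at hlt
  linarith

/-- The side keeps its line, and hence its distance to the origin, when an end slides along it:
length and determinant are both multiplied by `1 + t`. -/
lemma eventually_scaled {a : ℝ} {A B A' B' : Plane} (h : a * ‖B - A‖ ≤ cross A B)
    (hd : B' - A' = B - A) (hc : ∀ t : ℝ, cross (A + t • A') (B + t • B') = (1 + t) * cross A B) :
    ∀ᶠ t : ℝ in 𝓝 0, a * ‖B + t • B' - (A + t • A')‖ ≤ cross (A + t • A') (B + t • B') := by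
  have hpos : ∀ᶠ t : ℝ in 𝓝 0, -1 < t := lt_mem_nhds (by norm_num)
  filter_upwards [hpos] with t ht
  have ht' : 0 < 1 + t := by linarith
  have e1 : B + t • B' - (A + t • A') = (1 + t) • (B - A) := by
    have : B + t • B' - (A + t • A') = (B - A) + t • (B' - A') := by rw [smul_sub]; abel
    rw [this, hd, add_smul, one_smul]
  rw [e1, hc, norm_smul, Real.norm_of_nonneg ht'.le]
  nlinarith

lemma eventually_constraint_of_lt {a : ℝ} {A B : Plane} (h : a * ‖B - A‖ < cross A B)
    (A' B' : Plane) :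
    ∀ᶠ t : ℝ in 𝓝 0, a * ‖B + t • B' - (A + t • A')‖ ≤ cross (A + t • A') (B + t • B') := by
  have c1 : Continuous fun t : ℝ => a * ‖B + t • B' - (A + t • A')‖ := by fun_prop
  have c2 : Continuous fun t : ℝ => cross (A + t • A') (B + t • B') := by
    unfold cross; fun_prop
  filter_upwards [c1.continuousAt.eventually_lt c2.continuousAt (x₀ := 0) (by simpa using h)]
    with t ht using ht.le

lemma ConvexCycle.eq_of_succ_mod_eq {n : ℕ} {i j : ℕ} (hi : i < n) (hj : j < n)
    (he : (i + 1) % n = (j + 1) % n) : i = j := by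
  have := Nat.ModEq.add_right_cancel' 1 he
  rwa [Nat.ModEq, Nat.mod_eq_of_lt hi, Nat.mod_eq_of_lt hj] at this

/-- At a vertex inside the outer disc, let `k` be one of the sides and `j` the other one. If `k`
does not touch the inner disc, the vertex can be moved along `j`. -/
lemma side_tangent_aux {a b lam : ℝ} {n : ℕ} {v : ℕ → Plane} (h : ConvexCycle n v)
    (ha : 0 ≤ a) (hopt : IsOptimal a b lam (polygon n v)) {k j m : ℕ} (hk : k < n)
    (hj : j < n) (hb : ‖v m‖ < b)
    (hlt : a * ‖v (k + 1) - v k‖ < cross (v k) (v (k + 1)))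
    (u : Plane)
    (hd : (j = m ∧ u = v j - v (j + 1)) ∨ (v (j + 1) = v m ∧ u = v (j + 1) - v j))
    (hother : ∀ i < n, i ≠ k → i ≠ j → v i ≠ v m ∧ v (i + 1) ≠ v m)
    (hkm : (v k = v m ∧ cross (v (k + 1) - v k) u ≠ 0) ∨
      (v (k + 1) = v m ∧ cross (v (k + 1) - v k) u ≠ 0)) : False := by
  have hin := (h.closedBall_subset_iff ha).1 hopt.1.2.1
  classical
  obtain ⟨c, hc, hc'⟩ : ∃ c : ℕ → Plane, (∀ k, v k = v m → c k = u) ∧ ∀ k, v k ≠ v m → c k = 0 :=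
    ⟨fun k => if v k = v m then u else 0, fun k hk => if_pos hk, fun k hk => if_neg hk⟩
  have hz := cross_eq_zero_of_movable h ha hopt (v m) u hb c hc hc' ?_ k hk
  · have hne := h.apply_succ_ne hk
    rcases hkm with ⟨h1, h2⟩ | ⟨h1, h2⟩
    · rw [hc _ h1, hc' _ (by rwa [h1] at hne)] at hz
      apply h2
      simp [cross] at hz ⊢; linarith
    · rw [hc _ h1, hc' _ (by rw [h1] at hne; exact hne.symm)] at hz
      apply h2
      simpa using hz
  · intro i hi
    by_cases hik : i = k
    · subst hik; exact eventually_constraint_of_lt hlt _ _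
    by_cases hij : i = j
    · subst hij
      have hne := h.apply_succ_ne hi
      rcases hd with ⟨h1, rfl⟩ | ⟨h1, rfl⟩
      · have c1 := hc i (by rw [h1])
        have c2 := hc' (i + 1) (by rwa [h1] at hne ⊢)
        apply eventually_scaled (hin i hi)
        · rw [c1, c2]; abel
        · intro t; rw [c1, c2]; simp [cross]; ring
      · have c1 := hc (i + 1) h1
        have c2 := hc' i (by rw [h1] at hne; exact hne.symm)
        apply eventually_scaled (hin i hi)
        · rw [c1, c2]; abel
        · intro t; rw [c1, c2]; simp [cross]; ring
    · obtain ⟨h1, h2⟩ := hother i hi hik hij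
      rw [hc' _ h1, hc' _ h2]
      refine Eventually.of_forall fun t => ?_
      simpa using hin i hi

/-- Both sides of an optimal polygon at a vertex inside the outer disc touch the inner disc. -/
lemma side_tangent_of_norm_lt {a b lam : ℝ} {n : ℕ} {v : ℕ → Plane} (h : ConvexCycle n v)
    (ha : 0 ≤ a) (hopt : IsOptimal a b lam (polygon n v)) {k : ℕ} (hk : k < n)
    (hb : ‖v k‖ < b ∨ ‖v (k + 1)‖ < b) :
    a * ‖v (k + 1) - v k‖ = cross (v k) (v (k + 1)) := by
  have hin := (h.closedBall_subset_iff ha).1 hopt.1.2.1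
  by_contra hne
  have hlt := lt_of_le_of_ne (hin k hk) hne
  have h3 := h.three_le
  rcases hb with hb | hb
  · obtain ⟨j, hj, hjk⟩ : ∃ j < n, (j + 1) % n = k := by
      rcases Nat.eq_zero_or_pos k with rfl | h0
      · exact ⟨n - 1, by omega, by rw [show n - 1 + 1 = n by omega, Nat.mod_self]⟩
      · exact ⟨k - 1, by omega, by rw [show k - 1 + 1 = k by omega, Nat.mod_eq_of_lt hk]⟩
    have hvj : v (j + 1) = v k := by rw [← hjk, h.apply_mod hj]
    have hjk' : j ≠ k := fun e => h.succ_mod_ne hj (by omega)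
    refine side_tangent_aux h ha hopt hk hj hb hlt (v (j + 1) - v j) (Or.inr ⟨hvj, rfl⟩) ?_
      (Or.inl ⟨rfl, fun hz => ?_⟩)
    · intro i hi hik hij
      refine ⟨fun e => hik (h.injOn hi hk e), fun e => hij ?_⟩
      rw [← h.apply_mod hi] at e
      exact ConvexCycle.eq_of_succ_mod_eq hi hj
        ((h.injOn (Nat.mod_lt _ h.pos_n) hk e).trans hjk.symm)
    -- Consecutive sides are not parallel, as the orientation of their three ends is positive.
    · rcases h.orient_side_pos_or hj hk hjk' with hp | hp
      · rw [hvj, orient_self_right] at hp; exact lt_irrefl _ hp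
      · rw [hvj] at hp hz
        simp [cross] at hz
        unfold orient at hp
        linarith
  · obtain ⟨j, hj, hjk⟩ : ∃ j < n, j = (k + 1) % n := ⟨_, Nat.mod_lt _ h.pos_n, rfl⟩
    have hvj : v j = v (k + 1) := by rw [hjk, h.apply_mod hk]
    have hjk' : j ≠ k := by rw [hjk]; exact h.succ_mod_ne hk
    rw [← hvj] at hb
    refine side_tangent_aux h ha hopt hk hj hb hlt (v j - v (j + 1)) (Or.inl ⟨rfl, rfl⟩) ?_
      (Or.inr ⟨hvj.symm, fun hz => ?_⟩)
    · intro i hi hik hij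
      refine ⟨fun e => hij (h.injOn hi hj e), fun e => hik ?_⟩
      rw [← h.apply_mod hi] at e
      exact ConvexCycle.eq_of_succ_mod_eq hi hk
        ((h.injOn (Nat.mod_lt _ h.pos_n) hj e).trans hjk)
    · rcases h.orient_side_pos_or hk hj (Ne.symm hjk') with hp | hp
      · rw [← hvj, orient_self_right] at hp; exact lt_irrefl _ hp
      · rw [← hvj] at hz hp
        simp [cross] at hz
        unfold orient at hp
        linarith

/-! ### Polar coordinates and polygons inscribed in the outer circle -/

/-- The point with polar coordinates `r`, `θ`. -/
noncomputable def pt (r θ : ℝ) : Plane := WithLp.toLp 2 ![r * Real.cos θ, r * Real.sin θ]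

@[simp] lemma pt_zero (r θ : ℝ) : pt r θ 0 = r * Real.cos θ := rfl

@[simp] lemma pt_one (r θ : ℝ) : pt r θ 1 = r * Real.sin θ := rfl

lemma norm_pt {r : ℝ} (hr : 0 ≤ r) (θ : ℝ) : ‖pt r θ‖ = r := by
  rw [← sq_eq_sq₀ (norm_nonneg _) hr, norm_sq_plane, pt_zero, pt_one]
  linear_combination r ^ 2 * Real.sin_sq_add_cos_sq θ

lemma pt_add_two_pi (r θ : ℝ) : pt r (θ + 2 * Real.pi) = pt r θ := by
  simp [pt]

lemma cross_pt (r r' θ θ' : ℝ) : cross (pt r θ) (pt r' θ') = r * r' * Real.sin (θ' - θ) := by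
  rw [Real.sin_sub, cross, pt_zero, pt_one, pt_zero, pt_one]; ring

lemma inner_pt (r r' θ θ' : ℝ) : inner ℝ (pt r θ) (pt r' θ') = r * r' * Real.cos (θ' - θ) := by
  rw [Real.cos_sub, inner_plane, pt_zero, pt_one, pt_zero, pt_one]; ring

lemma norm_pt_sub_sq (r r' θ θ' : ℝ) :
    ‖pt r' θ' - pt r θ‖ ^ 2 = r ^ 2 + r' ^ 2 - 2 * r * r' * Real.cos (θ' - θ) := by
  rw [Real.cos_sub, norm_sq_plane]
  simp only [PiLp.sub_apply, pt_zero, pt_one]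
  linear_combination r ^ 2 * Real.sin_sq_add_cos_sq θ + r' ^ 2 * Real.sin_sq_add_cos_sq θ'

lemma norm_chord {b θ θ' : ℝ} (hb : 0 ≤ b) (h0 : θ ≤ θ') (h1 : θ' ≤ θ + 2 * Real.pi) :
    ‖pt b θ' - pt b θ‖ = 2 * b * Real.sin ((θ' - θ) / 2) := by
  have hs : 0 ≤ Real.sin ((θ' - θ) / 2) :=
    Real.sin_nonneg_of_nonneg_of_le_pi (by linarith) (by linarith)
  rw [← sq_eq_sq₀ (norm_nonneg _) (by positivity), norm_pt_sub_sq]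
  have : Real.cos (θ' - θ) = 1 - 2 * Real.sin ((θ' - θ) / 2) ^ 2 := by
    rw [Real.sin_sq, show θ' - θ = 2 * ((θ' - θ) / 2) by ring, Real.cos_two_mul]; ring_nf
  rw [this]; ring

/-- The area of an inscribed triangle as a product of sines of half-angles; it is visibly positive
for arguments increasing within one turn. -/
lemma orient_pt (b x y z : ℝ) : orient (pt b x) (pt b y) (pt b z) =
    4 * b ^ 2 * (Real.sin ((y - x) / 2) * Real.sin ((z - y) / 2) * Real.sin ((z - x) / 2)) := by
  rw [orient_eq_cross, cross_pt, cross_pt, cross_pt]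
  obtain ⟨p, rfl⟩ : ∃ p, y = x + 2 * p := ⟨(y - x) / 2, by ring⟩
  obtain ⟨q, rfl⟩ : ∃ q, z = x + 2 * p + 2 * q := ⟨(z - (x + 2 * p)) / 2, by ring⟩
  rw [show x + 2 * p - x = 2 * p by ring, show x + 2 * p + 2 * q - (x + 2 * p) = 2 * q by ring,
    show x + 2 * p + 2 * q - x = 2 * (p + q) by ring, mul_div_cancel_left₀ _ two_ne_zero,
    mul_div_cancel_left₀ _ two_ne_zero, mul_div_cancel_left₀ _ two_ne_zero, Real.sin_two_mul,
    Real.sin_two_mul, Real.sin_two_mul, Real.sin_add, Real.cos_add]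
  have hp := Real.sin_sq_add_cos_sq p
  have hq := Real.sin_sq_add_cos_sq q
  linear_combination
    (-2 * b ^ 2 * Real.sin q * Real.cos q) * hp + (-2 * b ^ 2 * Real.sin p * Real.cos p) * hq

lemma convexCycle_pt {b : ℝ} (hb : 0 < b) {n : ℕ} (hn : 3 ≤ n) {θ : ℕ → ℝ}
    (hlt : ∀ i j, i < j → j ≤ n → θ i < θ j) (hclosed : θ n = θ 0 + 2 * Real.pi) :
    ConvexCycle n fun k => pt b (θ k) where
  three_le := hn
  closed := by rw [hclosed, pt_add_two_pi]
  pos := by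
    intro i j k hij hjk hk
    have h1 := hlt i j hij (by omega)
    have h2 := hlt j k hjk (by omega)
    have h3 := hlt k n hk le_rfl
    have h4 : θ 0 ≤ θ i := by
      rcases Nat.eq_zero_or_pos i with rfl | h0
      · exact le_rfl
      · exact (hlt 0 i h0 (by omega)).le
    rw [orient_pt]
    have s1 : 0 < Real.sin ((θ j - θ i) / 2) :=
      Real.sin_pos_of_pos_of_lt_pi (by linarith) (by linarith)
    have s2 : 0 < Real.sin ((θ k - θ j) / 2) :=
      Real.sin_pos_of_pos_of_lt_pi (by linarith) (by linarith)
    have s3 : 0 < Real.sin ((θ k - θ i) / 2) :=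
      Real.sin_pos_of_pos_of_lt_pi (by linarith) (by linarith)
    positivity

/-- The contribution to `J lam` of a chord of the circle of radius `b` with chord angle `η`. -/
noncomputable def chordJ (b lam η : ℝ) : ℝ := b * Real.sin η * (lam * b * Real.cos η - 2)

lemma chordJ_term {b lam θ θ' : ℝ} (hb : 0 ≤ b) (h0 : θ ≤ θ') (h1 : θ' ≤ θ + 2 * Real.pi) :
    lam / 2 * cross (pt b θ) (pt b θ') - ‖pt b θ' - pt b θ‖ = chordJ b lam ((θ' - θ) / 2) := by
  rw [norm_chord hb h0 h1, cross_pt, chordJ]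
  obtain ⟨p, rfl⟩ : ∃ p, θ' = θ + 2 * p := ⟨(θ' - θ) / 2, by ring⟩
  rw [show θ + 2 * p - θ = 2 * p by ring, mul_div_cancel_left₀ _ two_ne_zero, Real.sin_two_mul]
  ring

lemma xi0_pos {a b : ℝ} (ha : 0 < a) (hab : a < b) : 0 < xi0 a b :=
  Real.arccos_pos.2 ((div_lt_one (ha.trans hab)).2 hab)

lemma xi0_lt {a b : ℝ} (ha : 0 < a) (hab : a < b) : xi0 a b < Real.pi / 2 := by
  have hb := ha.trans hab
  exact Real.arccos_lt_pi_div_two.2 (by positivity)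

lemma cos_xi0 {a b : ℝ} (ha : 0 < a) (hab : a < b) : Real.cos (xi0 a b) = a / b := by
  have hb := ha.trans hab
  exact Real.cos_arccos (by have : 0 < a / b := by positivity
                            linarith) ((div_lt_one hb).2 hab).le

lemma le_xi0_iff {a b η : ℝ} (ha : 0 < a) (hab : a < b) (h0 : 0 ≤ η) (h1 : η ≤ Real.pi) :
    η ≤ xi0 a b ↔ a ≤ b * Real.cos η := by
  have hb := ha.trans hab
  have h2 := xi0_lt ha hab
  have h3 := xi0_pos ha hab
  rw [← div_le_iff₀' hb, ← cos_xi0 ha hab]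
  exact (Real.strictAntiOn_cos.le_iff_ge (Set.mem_Icc.2 ⟨h3.le, by linarith⟩) ⟨h0, h1⟩).symm

/-- The vertices are placed at arguments equal to twice the partial sums of `η`. The bound by `ξ₀`
keeps every chord off the open inner disc. -/
lemma exists_admissible_of_seq {a b : ℝ} (lam : ℝ) (ha : 0 < a) (hab : a < b) {n : ℕ} {η : ℕ → ℝ}
    (hpos : ∀ k < n, 0 < η k) (hle : ∀ k < n, η k ≤ xi0 a b)
    (hsum : ∑ k ∈ Finset.range n, η k = Real.pi) :
    ∃ K ∈ admissible a b, J lam K = ∑ k ∈ Finset.range n, chordJ b lam (η k) := by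
  have hb := ha.trans hab
  have hxi := xi0_lt ha hab
  have hpi := Real.pi_pos
  -- Two angles below `π / 2` cannot add up to `π`.
  have hn : 3 ≤ n := by
    by_contra hn
    have : ∑ k ∈ Finset.range n, η k ≤ n * xi0 a b := by
      simpa using Finset.sum_le_card_nsmul (Finset.range n) η (xi0 a b)
        fun k hk => hle k (Finset.mem_range.1 hk)
    have h2 : (n : ℝ) ≤ 2 := by exact_mod_cast (by omega : n ≤ 2)
    have := xi0_pos ha hab
    nlinarith
  let θ : ℕ → ℝ := fun k => 2 * ∑ i ∈ Finset.range k, η i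
  have hstep : ∀ k, θ (k + 1) - θ k = 2 * η k := fun k => by
    simp only [θ, Finset.sum_range_succ]; ring
  have hlt : ∀ i j, i < j → j ≤ n → θ i < θ j := by
    intro i j hij
    induction j, hij using Nat.le_induction with
    | base => intro hj; have := hpos i hj; have := hstep i; linarith
    | succ j _ ih =>
      intro hj; have := ih (by omega); have := hpos j hj; have := hstep j; linarith
  have hcyc : ConvexCycle n fun k => pt b (θ k) :=
    convexCycle_pt hb hn hlt (by simp [θ, hsum])
  have hnc : ∀ k < n, θ k ≤ θ (k + 1) ∧ θ (k + 1) ≤ θ k + 2 * Real.pi := fun k hk => by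
    have := hpos k hk; have := hstep k; have := hle k hk
    constructor <;> linarith
  refine ⟨_, hcyc.mem_admissible (b := b) ha.le ?_ ?_, ?_⟩
  · intro k hk
    have e := (le_xi0_iff ha hab (hpos k hk).le (by have := hle k hk; linarith)).1 (hle k hk)
    have hs : 0 < Real.sin (η k) :=
      Real.sin_pos_of_pos_of_lt_pi (hpos k hk) (by have := hle k hk; linarith)
    rw [norm_chord hb.le (hnc k hk).1 (hnc k hk).2, cross_pt, hstep,
      mul_div_cancel_left₀ _ two_ne_zero, Real.sin_two_mul]
    have := mul_le_mul_of_nonneg_left e (mul_pos hb hs).le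
    linarith
  · intro k _; exact (norm_pt hb.le _).le
  · rw [hcyc.J_polygon]
    refine Finset.sum_congr rfl fun k hk => ?_
    have hk' := hnc k (Finset.mem_range.1 hk)
    rw [chordJ_term hb.le hk'.1 hk'.2, hstep, mul_div_cancel_left₀ _ two_ne_zero]

/-- The polygons inscribed in the outer circle realize every family of chord angles in `[0, ξ₀]`
with sum `π`. -/
lemma exists_admissible_of_family {a b : ℝ} (lam : ℝ) (ha : 0 < a) (hab : a < b) {ι : Type*}
    (s : Finset ι) {η : ι → ℝ} (hpos : ∀ i ∈ s, 0 ≤ η i) (hle : ∀ i ∈ s, η i ≤ xi0 a b)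
    (hsum : ∑ i ∈ s, η i = Real.pi) :
    ∃ K ∈ admissible a b, J lam K = ∑ i ∈ s, chordJ b lam (η i) := by
  classical
  -- Zero angles would repeat a vertex. They are dropped, which changes neither sum because `chordJ
  -- b lam 0 = 0`.
  let s' := s.filter fun i => η i ≠ 0
  let e := s'.equivFin.symm
  let ζ : ℕ → ℝ := fun k => if hk : k < s'.card then η (e ⟨k, hk⟩) else 0
  have key : ∀ g : ℝ → ℝ, g 0 = 0 →
      ∑ k ∈ Finset.range s'.card, g (ζ k) = ∑ i ∈ s, g (η i) := by
    intro g hg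
    have h1 : ∑ i ∈ s, g (η i) = ∑ i ∈ s', g (η i) := by
      symm
      apply Finset.sum_filter_of_ne
      intro i _ hne h0
      exact hne (by rw [h0, hg])
    rw [h1, Finset.sum_range, ← Finset.sum_coe_sort s', ← Equiv.sum_comp e]
    exact Finset.sum_congr rfl fun k _ => by simp [ζ]
  have hmem : ∀ k, ∀ hk : k < s'.card, ((e ⟨k, hk⟩ : s') : ι) ∈ s ∧ η (e ⟨k, hk⟩) ≠ 0 :=
    fun k hk => Finset.mem_filter.1 (e ⟨k, hk⟩).2
  have h1 : ∀ k < s'.card, 0 < ζ k := by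
    intro k hk
    obtain ⟨h1, h2⟩ := hmem k hk
    simp only [ζ, dif_pos hk]
    exact lt_of_le_of_ne (hpos _ h1) (Ne.symm h2)
  have h2 : ∀ k < s'.card, ζ k ≤ xi0 a b := by
    intro k hk
    simp only [ζ, dif_pos hk]
    exact hle _ (hmem k hk).1
  obtain ⟨K, hK, hJ⟩ := exists_admissible_of_seq lam ha hab h1 h2
    ((key (fun x => x) rfl).trans hsum)
  exact ⟨K, hK, hJ.trans (key _ (by simp [chordJ]))⟩

/-! ### Ordering the vertices of an admissible polygon around the origin -/

/-- The argument of a plane vector. -/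
noncomputable def ang (P : Plane) : ℝ := Complex.arg ⟨P 0, P 1⟩

lemma pt_ang (P : Plane) : pt ‖P‖ (ang P) = P := by
  have hn : ‖(⟨P 0, P 1⟩ : ℂ)‖ = ‖P‖ := by
    rw [← sq_eq_sq₀ (norm_nonneg _) (norm_nonneg _), norm_sq_plane, Complex.sq_norm,
      Complex.normSq_apply]
    ring
  apply plane_ext
  · rw [pt_zero, ← hn]; exact Complex.norm_mul_cos_arg _
  · rw [pt_one, ← hn]; exact Complex.norm_mul_sin_arg _

/-- An extreme point of `Ω` lying in the triangle `0 P R` contained in `Ω` is extreme in that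
triangle, hence one of its vertices. -/
lemma eq_or_eq_of_extreme {Ω : Set Plane} (hΩ : Convex ℝ Ω) (h0 : (0 : Plane) ∈ Ω)
    {P Q R : Plane} (hP : P ∈ Ω) (hR : R ∈ Ω) (hQ : Q ∈ Ω.extremePoints ℝ) (hQ0 : Q ≠ 0)
    {s t : ℝ} (hs : 0 ≤ s) (ht : 0 ≤ t) (hst : s + t ≤ 1) (he : Q = s • P + t • R) :
    Q = P ∨ Q = R := by
  have hmem : Q ∈ tri 0 P R := ⟨WithLp.toLp 2 ![s, t], ⟨by simpa, by simpa, by simpa⟩, by simp [he]⟩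
  have hsub : convexHull ℝ ({0, P, R} : Set Plane) ⊆ Ω :=
    convexHull_min (by rintro x (rfl | rfl | rfl) <;> assumption) hΩ
  have hmem' : Q ∈ convexHull ℝ ({0, P, R} : Set Plane) :=
    tri_subset (convex_convexHull _ _) (subset_convexHull _ _ (by simp))
      (subset_convexHull _ _ (by simp)) (subset_convexHull _ _ (by simp)) hmem
  have := extremePoints_convexHull_subset
    (inter_extremePoints_subset_extremePoints_of_subset hsub ⟨hmem', hQ⟩)
  rcases this with h | h | h
  · exact absurd h hQ0
  · exact Or.inl h
  · exact Or.inr h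

/-- Otherwise the middle point, written in terms of the other two by Cramer's rule, would have
coefficients with sum at most one and lie in the triangle they form with the origin. -/
lemma orient_pos_of_extreme {Ω : Set Plane} (hΩ : Convex ℝ Ω) (h0 : (0 : Plane) ∈ Ω)
    {r r' r'' α β γ : ℝ} (hr : 0 < r) (hr' : 0 < r') (hr'' : 0 < r'')
    (hP : pt r α ∈ Ω) (hR : pt r'' γ ∈ Ω) (hQ : pt r' β ∈ Ω.extremePoints ℝ)
    (h1 : α < β) (h2 : β < γ) (h3 : γ < α + Real.pi) :
    0 < orient (pt r α) (pt r' β) (pt r'' γ) := by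
  have s1 : 0 < Real.sin (β - α) := Real.sin_pos_of_pos_of_lt_pi (by linarith) (by linarith)
  have s2 : 0 < Real.sin (γ - β) := Real.sin_pos_of_pos_of_lt_pi (by linarith) (by linarith)
  have s3 : 0 < Real.sin (γ - α) := Real.sin_pos_of_pos_of_lt_pi (by linarith) (by linarith)
  have c1 : cross (pt r α) (pt r' β) = r * r' * Real.sin (β - α) := cross_pt ..
  have c2 : cross (pt r' β) (pt r'' γ) = r' * r'' * Real.sin (γ - β) := cross_pt ..
  have c3 : cross (pt r α) (pt r'' γ) = r * r'' * Real.sin (γ - α) := cross_pt ..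
  have d1 : 0 < cross (pt r α) (pt r' β) := by rw [c1]; positivity
  have d2 : 0 < cross (pt r' β) (pt r'' γ) := by rw [c2]; positivity
  have d3 : 0 < cross (pt r α) (pt r'' γ) := by rw [c3]; positivity
  have hself : ∀ x : Plane, cross x x = 0 := fun x => by unfold cross; ring
  by_contra hneg
  rw [not_lt, orient_eq_cross] at hneg
  have hQ0 : pt r' β ≠ 0 := fun h => by rw [h] at d1; simp [cross] at d1
  have he : pt r' β = (cross (pt r' β) (pt r'' γ) / cross (pt r α) (pt r'' γ)) • pt r α +
      (cross (pt r α) (pt r' β) / cross (pt r α) (pt r'' γ)) • pt r'' γ := by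
    have hne := d3.ne'
    generalize pt r α = P at *
    generalize pt r' β = Q at *
    generalize pt r'' γ = R at *
    apply plane_ext <;> simp only [PiLp.add_apply, PiLp.smul_apply, smul_eq_mul] <;>
      field_simp <;> unfold cross <;> ring
  rcases eq_or_eq_of_extreme hΩ h0 hP hR hQ hQ0 (div_pos d2 d3).le (div_pos d1 d3).le
    (by rw [← add_div, div_le_one d3]; linarith) he with h | h
  · rw [h, hself] at d1; exact lt_irrefl _ d1
  · rw [h, hself] at d2; exact lt_irrefl _ d2

lemma not_ball_subset_segment {a : ℝ} (ha : 0 < a) (P Q : Plane) :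
    ¬ Metric.closedBall 0 a ⊆ segment ℝ P Q := by
  intro hs
  have key : ∀ x ∈ segment ℝ P Q, ∀ y ∈ segment ℝ P Q, ∀ z ∈ segment ℝ P Q, orient x y z = 0 := by
    intro x hx y hy z hz
    rw [segment_eq_image'] at hx hy hz
    obtain ⟨s, -, rfl⟩ := hx
    obtain ⟨t, -, rfl⟩ := hy
    obtain ⟨u, -, rfl⟩ := hz
    simp [orient]; ring
  have hmem : ∀ θ, pt a θ ∈ segment ℝ P Q := fun θ =>
    hs (mem_closedBall_zero_iff.2 (norm_pt ha.le θ).le)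
  have := key _ (hmem 0) _ (hmem (Real.pi / 2)) _ (hmem Real.pi)
  simp [orient] at this
  rcases this with h | h <;> linarith

/-- An admissible convex polygon is a cycle of vertices around the origin. -/
lemma exists_cycle {a b : ℝ} (ha : 0 < a) {Ω : Set Plane} (hpoly : IsConvexPolygon Ω)
    (hadm : Ω ∈ admissible a b) :
    ∃ (n : ℕ) (r θ : ℕ → ℝ), ConvexCycle n (fun k => pt (r k) (θ k)) ∧
      Ω = polygon n (fun k => pt (r k) (θ k)) ∧
      Ω.extremePoints ℝ = (fun k => pt (r k) (θ k)) '' Set.Iio n ∧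
      (∀ k ≤ n, 0 < r k) ∧ r n = r 0 ∧ θ n = θ 0 + 2 * Real.pi ∧
      ∀ k < n, θ k < θ (k + 1) ∧ θ (k + 1) < θ k + Real.pi := by
  classical
  have hpi := Real.pi_pos
  obtain ⟨hconv, hball, -⟩ := hadm
  have h0 : (0 : Plane) ∈ Ω := hball (by simpa using ha.le)
  have hint : (0 : Plane) ∈ interior Ω :=
    interior_mono hball (mem_interior_iff_mem_nhds.2 (Metric.closedBall_mem_nhds _ ha))
  obtain ⟨S, hS, rfl⟩ := hpoly
  set Ω := convexHull ℝ S
  have hEfin : (Ω.extremePoints ℝ).Finite := hS.subset extremePoints_convexHull_subset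
  have hE : convexHull ℝ (Ω.extremePoints ℝ) = Ω := by
    have h1 := closure_convexHull_extremePoints (hS.isCompact_convexHull ℝ) hconv
    rwa [(hEfin.isClosed_convexHull ℝ).closure_eq] at h1
  have hE0 : ∀ P ∈ Ω.extremePoints ℝ, P ≠ 0 := by
    rintro P hP rfl
    have hm : ∀ θ, pt a θ ∈ Ω := fun θ => hball (mem_closedBall_zero_iff.2 (norm_pt ha.le θ).le)
    have := hP.2 (hm 0) (hm Real.pi) ⟨1 / 2, 1 / 2, by norm_num, by norm_num, by norm_num, by
      apply plane_ext <;> simp⟩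
    have h2 := norm_pt ha.le 0
    rw [this, norm_zero] at h2
    exact ha.ne h2
  have hinj : Set.InjOn ang (Ω.extremePoints ℝ) := by
    have key : ∀ P ∈ Ω.extremePoints ℝ, ∀ Q ∈ Ω.extremePoints ℝ, ang P = ang Q → ‖P‖ ≤ ‖Q‖ →
        P = Q := by
      intro P hP Q hQ hPQ hle
      have hQpos : 0 < ‖Q‖ := norm_pos_iff.2 (hE0 Q hQ)
      have he : P = (‖P‖ / ‖Q‖) • Q + (0 : ℝ) • Q := by
        rw [zero_smul, add_zero]
        conv_lhs => rw [← pt_ang P, hPQ]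
        conv_rhs => rw [← pt_ang Q]
        rw [norm_pt hQpos.le]
        apply plane_ext <;> simp <;> field_simp
      rcases eq_or_eq_of_extreme hconv h0 hQ.1 hQ.1 hP (hE0 P hP) (by positivity) le_rfl
        (by rwa [add_zero, div_le_one hQpos]) he with h | h <;> exact h
    intro P hP Q hQ hPQ
    rcases le_total ‖P‖ ‖Q‖ with hle | hle
    · exact key P hP Q hQ hPQ hle
    · exact (key Q hQ P hP hPQ.symm hle).symm
  -- Distinct extreme points have distinct arguments, so sorting the arguments enumerates the
  -- vertices; the index `n` stands for the first vertex after one full turn.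
  let A : Finset ℝ := hEfin.toFinset.image ang
  let n := A.card
  have hne : (Ω.extremePoints ℝ).Nonempty := by
    rw [← convexHull_nonempty_iff (𝕜 := ℝ), hE]; exact ⟨0, h0⟩
  have hn : 0 < n := by
    obtain ⟨P, hP⟩ := hne
    exact Finset.card_pos.2 ⟨ang P, Finset.mem_image_of_mem _ (hEfin.mem_toFinset.2 hP)⟩
  let φ : Fin n ↪o ℝ := A.orderEmbOfFin rfl
  have hφ : ∀ i, ∃ P ∈ Ω.extremePoints ℝ, ang P = φ i := by
    intro i
    have := A.orderEmbOfFin_mem rfl i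
    obtain ⟨P, hP, he⟩ := Finset.mem_image.1 this
    exact ⟨P, hEfin.mem_toFinset.1 hP, he⟩
  choose p hp hpang using hφ
  have hp_surj : ∀ P ∈ Ω.extremePoints ℝ, ∃ i, p i = P := by
    intro P hP
    have : ang P ∈ Set.range φ := by
      rw [Finset.range_orderEmbOfFin]
      exact Finset.mem_image_of_mem _ (hEfin.mem_toFinset.2 hP)
    obtain ⟨i, hi⟩ := this
    exact ⟨i, hinj (hp i) hP (by rw [hpang, hi])⟩
  let θ : ℕ → ℝ := fun k => if hk : k < n then φ ⟨k, hk⟩ else φ ⟨0, hn⟩ + 2 * Real.pi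
  let r : ℕ → ℝ := fun k => if hk : k < n then ‖p ⟨k, hk⟩‖ else ‖p ⟨0, hn⟩‖
  have hv : ∀ k, ∀ hk : k < n, pt (r k) (θ k) = p ⟨k, hk⟩ := fun k hk => by
    simp only [r, θ, dif_pos hk]; rw [← hpang, pt_ang]
  have hvE : ∀ k < n, pt (r k) (θ k) ∈ Ω.extremePoints ℝ := fun k hk => by
    rw [hv k hk]; exact hp _
  have hrpos : ∀ k, 0 < r k := by
    intro k
    by_cases hk : k < n <;> simp only [r, hk, dite_true, dite_false] <;>
      exact norm_pos_iff.2 (hE0 _ (hp _))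
  have hrn : r n = r 0 := by simp only [r, hn, lt_irrefl, dite_true, dite_false]
  have hθn : θ n = θ 0 + 2 * Real.pi := by simp only [θ, hn, lt_irrefl, dite_true, dite_false]
  have hθlt : ∀ i j, i < j → j < n → θ i < θ j := by
    intro i j hij hj
    simp only [θ, hj, hij.trans hj, dite_true]
    exact φ.strictMono hij
  have hθspan : ∀ i j, i < n → j < n → θ j < θ i + 2 * Real.pi := by
    intro i j hi hj
    simp only [θ, hi, hj, dite_true]
    rw [← hpang, ← hpang]
    have h1 := Complex.neg_pi_lt_arg ⟨p ⟨i, hi⟩ 0, p ⟨i, hi⟩ 1⟩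
    have h2 := Complex.arg_le_pi ⟨p ⟨j, hj⟩ 0, p ⟨j, hj⟩ 1⟩
    simp only [ang]
    linarith
  have himage : (fun k => pt (r k) (θ k)) '' Set.Iio n = Ω.extremePoints ℝ := by
    ext P
    constructor
    · rintro ⟨k, hk, rfl⟩; exact hvE k hk
    · intro hP
      obtain ⟨i, rfl⟩ := hp_surj P hP
      exact ⟨i, i.2, hv i i.2⟩
  have hΩ : Ω = polygon n fun k => pt (r k) (θ k) := by rw [polygon, himage, hE]
  have hn3 : 3 ≤ n := by
    by_contra hlt
    apply not_ball_subset_segment ha (pt (r 0) (θ 0)) (pt (r 1) (θ 1))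
    refine hball.trans ?_
    rw [hΩ]
    refine convexHull_min ?_ (convex_segment _ _)
    rintro _ ⟨k, hk, rfl⟩
    have hk : k < n := hk
    have : k = 0 ∨ k = 1 := by omega
    rcases this with rfl | rfl
    · exact left_mem_segment _ _ _
    · exact right_mem_segment _ _ _
  have hcyc : ConvexCycle n fun k => pt (r k) (θ k) := by
    refine ⟨hn3, by rw [hrn, hθn, pt_add_two_pi], ?_⟩
    intro i j k hij hjk hk
    have hj := hjk.trans hk
    have hi := hij.trans hj
    have l1 := hθlt i j hij hj
    have l2 := hθlt j k hjk hk
    have l3 := hθspan i k hi hk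
    have ei := hvE i hi
    have ej := hvE j hj
    have ek := hvE k hk
    show 0 < orient (pt (r i) (θ i)) (pt (r j) (θ j)) (pt (r k) (θ k))
    -- If one of the three angular gaps exceeds `π`, the points lie in a half-plane and the
    -- preceding lemma applies after a cyclic rotation. Otherwise all gaps are at most `π`, and the
    -- orientation is a sum of nonnegative determinants, one of them positive.
    by_cases ha1 : θ k < θ i + Real.pi
    · exact orient_pos_of_extreme hconv h0 (hrpos i) (hrpos j) (hrpos k) ei.1 ek.1 ej l1 l2 ha1
    by_cases ha2 : θ i + Real.pi < θ j
    · rw [orient_rotate, ← pt_add_two_pi (r i)]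
      rw [← pt_add_two_pi] at ei
      exact orient_pos_of_extreme hconv h0 (hrpos j) (hrpos k) (hrpos i) ej.1 ei.1 ek l2 l3
        (by linarith)
    by_cases ha3 : θ j + Real.pi < θ k
    · rw [← orient_rotate, ← pt_add_two_pi (r i), ← pt_add_two_pi (r j)]
      rw [← pt_add_two_pi] at ei ej
      exact orient_pos_of_extreme hconv h0 (hrpos k) (hrpos i) (hrpos j) ek.1 ej.1 ei l3
        (by linarith) (by linarith)
    · have s1 : 0 ≤ Real.sin (θ j - θ i) :=
        Real.sin_nonneg_of_nonneg_of_le_pi (by linarith) (by linarith)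
      have s2 : 0 ≤ Real.sin (θ k - θ j) :=
        Real.sin_nonneg_of_nonneg_of_le_pi (by linarith) (by linarith)
      have s3 : 0 ≤ Real.sin (θ k - θ i - Real.pi) :=
        Real.sin_nonneg_of_nonneg_of_le_pi (by linarith) (by linarith)
      rw [Real.sin_sub_pi] at s3
      have hij' := mul_pos (hrpos i) (hrpos j)
      have hjk' := mul_pos (hrpos j) (hrpos k)
      have hik' := mul_pos (hrpos i) (hrpos k)
      have m3 := mul_nonneg hik'.le s3
      rw [orient_eq_cross, cross_pt, cross_pt, cross_pt]
      by_cases hlt : θ j - θ i < Real.pi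
      · have := mul_pos hij' (Real.sin_pos_of_pos_of_lt_pi (by linarith) hlt)
        have := mul_nonneg hjk'.le s2
        linarith
      · have := mul_pos hjk' (Real.sin_pos_of_pos_of_lt_pi (x := θ k - θ j)
          (by linarith) (by linarith))
        have := mul_nonneg hij'.le s1
        linarith
  refine ⟨n, r, θ, hcyc, hΩ, himage.symm, fun k _ => hrpos k, hrn, hθn, ?_⟩
  intro k hk
  have hlt : θ k < θ (k + 1) ∧ θ (k + 1) ≤ θ k + 2 * Real.pi := by
    by_cases hk1 : k + 1 < n
    · exact ⟨hθlt _ _ (Nat.lt_succ_self k) hk1, (hθspan _ _ hk hk1).le⟩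
    · have hkn : k + 1 = n := by omega
      rw [hkn, hθn]
      refine ⟨hθspan _ _ hn hk, ?_⟩
      rcases Nat.eq_zero_or_pos k with rfl | hk0
      · exact le_rfl
      · linarith [hθlt 0 k hk0 hk]
  refine ⟨hlt.1, ?_⟩
  -- With a gap of `π` or more, the origin would not be strictly to the left of this side.
  by_contra hge
  rw [hΩ, hcyc.mem_interior_iff] at hint
  have h1 := hint k hk
  simp only [orient_eq_cross_add, cross_pt] at h1
  have h2 : 0 ≤ Real.sin (θ (k + 1) - θ k - Real.pi) :=
    Real.sin_nonneg_of_nonneg_of_le_pi (by linarith) (by linarith [hlt.2])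
  rw [Real.sin_sub_pi] at h2
  have h3 := mul_nonneg (mul_pos (hrpos k) (hrpos (k + 1))).le h2
  simp [cross] at h1
  linarith

/-! ### All vertices are on the outer circle -/

lemma arccos_angle {a r l : ℝ} (ha : 0 < a) (hr : 0 < r) (hl : 0 ≤ l) (h : r ^ 2 = a ^ 2 + l ^ 2) :
    Real.cos (Real.arccos (a / r)) = a / r ∧ Real.sin (Real.arccos (a / r)) = l / r ∧
      Real.arccos (a / r) < Real.pi / 2 := by
  have hle : a ≤ r := by
    rw [← sq_le_sq₀ ha.le hr.le]; nlinarith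
  have hpos : 0 < a / r := by positivity
  have hle1 : a / r ≤ 1 := (div_le_one hr).2 hle
  refine ⟨Real.cos_arccos (by linarith) hle1, ?_, Real.arccos_lt_pi_div_two.2 hpos⟩
  rw [Real.sin_arccos, show 1 - (a / r) ^ 2 = (l / r) ^ 2 by field_simp; linarith,
    Real.sqrt_sq (by positivity)]

/-- A segment touching the disc of radius `a` at one of its points. -/
lemma tangent_side {a r r' θ θ' : ℝ} (ha : 0 < a) (hr : 0 < r) (hr' : 0 < r')
    (h0 : θ < θ') (h1 : θ' < θ + Real.pi)
    (hfoot : foot a (pt r θ) (pt r' θ') ∈ segment ℝ (pt r θ) (pt r' θ')) :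
    θ' - θ = Real.arccos (a / r) + Real.arccos (a / r') ∧
      ‖pt r' θ' - pt r θ‖ =
        a * (Real.tan (Real.arccos (a / r)) + Real.tan (Real.arccos (a / r'))) := by
  set P := pt r θ
  set Q := pt r' θ'
  have hsin : 0 < Real.sin (θ' - θ) := Real.sin_pos_of_pos_of_lt_pi (by linarith) (by linarith)
  have hne : P ≠ Q := fun he => by
    have h2 : cross P Q = r * r' * Real.sin (θ' - θ) := cross_pt ..
    have h3 : 0 < cross P Q := by rw [h2]; positivity
    rw [he, cross] at h3; linarith
  have hin := inner_foot a P Q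
  have hnorm := norm_foot ha.le hne
  set T := foot a P Q
  obtain ⟨s, t, hs, ht, hst, hT⟩ := hfoot
  obtain rfl : s = 1 - t := by linarith
  have hL := norm_sq_plane (Q - P)
  have hP2 := norm_sq_plane P
  have hQ2 := norm_sq_plane Q
  have hT2 := norm_sq_plane T
  have hPQ : inner ℝ P Q = r * r' * Real.cos (θ' - θ) := inner_pt ..
  rw [show ‖P‖ = r from norm_pt hr.le θ] at hP2
  rw [show ‖Q‖ = r' from norm_pt hr'.le θ'] at hQ2
  rw [hnorm] at hT2
  rw [inner_plane] at hin hPQ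
  have hT0 : T 0 = (1 - t) * P 0 + t * Q 0 := by rw [← hT]; simp
  have hT1 : T 1 = (1 - t) * P 1 + t * Q 1 := by rw [← hT]; simp
  simp only [PiLp.sub_apply] at hL hin
  set L := ‖Q - P‖
  have hL0 : 0 ≤ L := norm_nonneg _
  rw [hT0, hT1] at hT2 hin
  -- Pythagoras in the two right triangles cut off by the point of contact, which is at distances `t
  -- * L` and `(1 - t) * L` from the ends.
  have e1 : r ^ 2 = a ^ 2 + (t * L) ^ 2 := by
    rw [mul_pow, hL, hP2, hT2]; linear_combination (-2 * t) * hin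
  have e2 : r' ^ 2 = a ^ 2 + ((1 - t) * L) ^ 2 := by
    rw [mul_pow, hL, hQ2, hT2]; linear_combination 2 * (1 - t) * hin
  have e3 : r * r' * Real.cos (θ' - θ) = a ^ 2 - (t * L) * ((1 - t) * L) := by
    rw [← hPQ, hT2, show (t * L) * ((1 - t) * L) = t * (1 - t) * L ^ 2 by ring, hL]
    linear_combination (1 - 2 * t) * hin
  obtain ⟨c1, s1, l1⟩ := arccos_angle ha hr (mul_nonneg ht hL0) e1
  obtain ⟨c2, s2, l2⟩ := arccos_angle ha hr' (mul_nonneg hs hL0) e2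
  have p1 := Real.arccos_nonneg (a / r)
  have p2 := Real.arccos_nonneg (a / r')
  constructor
  · apply Real.injOn_cos ⟨by linarith, by linarith⟩ ⟨by linarith, by linarith⟩
    rw [Real.cos_add, c1, c2, s1, s2]
    field_simp
    linear_combination e3
  · rw [Real.tan_eq_sin_div_cos, Real.tan_eq_sin_div_cos, c1, c2, s1, s2]
    field_simp; ring

/-- The contribution to `J lam` of a vertex whose sides both touch the inner disc, between the two
points of contact, as a function of half the angle seen from the origin. -/
noncomputable def kiteJ (a lam ω : ℝ) : ℝ := -((2 - lam * a) * a * Real.tan ω)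

/-- A tangent chord and a kite with its vertex on the outer circle consist of the same two right
triangles, glued along different edges. -/
lemma chordJ_xi0 {a b : ℝ} (lam : ℝ) (ha : 0 < a) (hab : a < b) :
    chordJ b lam (xi0 a b) = kiteJ a lam (xi0 a b) := by
  have hb := ha.trans hab
  rw [chordJ, kiteJ, Real.tan_eq_sin_div_cos, cos_xi0 ha hab]
  field_simp; ring

/-- Multiplied by `cos ω`, the difference is `sin ω * (b cos ω - a) * (2 - lam * (b cos ω + a))`.
The last factor is positive because `lam * b ≤ 1` and `a < b`. -/
lemma chordJ_lt_kiteJ {a b lam ω : ℝ} (ha : 0 < a) (hab : a < b) (hlam0 : 0 < lam)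
    (hlam : lam ≤ 1 / b) (h0 : 0 < ω) (h1 : ω < Real.pi / 2) (h2 : a < b * Real.cos ω) :
    chordJ b lam ω < kiteJ a lam ω := by
  have hb := ha.trans hab
  have hs : 0 < Real.sin ω := Real.sin_pos_of_pos_of_lt_pi h0 (by linarith [Real.pi_pos])
  have hc : 0 < Real.cos ω := Real.cos_pos_of_mem_Ioo ⟨by linarith, h1⟩
  have hc1 : b * Real.cos ω ≤ b := by nlinarith [Real.cos_le_one ω]
  rw [le_div_iff₀ hb] at hlam
  rw [chordJ, kiteJ, Real.tan_eq_sin_div_cos,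
    show -((2 - lam * a) * a * (Real.sin ω / Real.cos ω)) =
      (-((2 - lam * a) * a * Real.sin ω)) / Real.cos ω by ring, lt_div_iff₀ hc]
  have key : lam * (b * Real.cos ω + a) < 2 := by nlinarith
  have := mul_pos (sub_pos.2 h2) (sub_pos.2 key)
  have := mul_pos hs this
  linarith

/-- Distribution of the contributions of the sides: the sides without ends satisfying `c` keep
theirs; the halves of the others are regrouped at the vertices satisfying `c`, and in couples of
halves of value `x`. -/
lemma sum_regroup {n : ℕ} (c : ℕ → Prop) [DecidablePred c] (hc : c n ↔ c 0) (S W : ℕ → ℝ) (x : ℝ)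
    (hW : W n = W 0) (hx : ∀ k ≤ n, ¬ c k → W k = x)
    (hS : ∀ k < n, c k ∨ c (k + 1) → S k = (W k + W (k + 1)) / 2) :
    ∑ k ∈ Finset.range n, S k = ∑ k ∈ Finset.range n,
      ((if c k ∨ c (k + 1) then 0 else S k) + (if c k then W k else 0) +
        (if c k ∧ ¬ c (k + 1) then x else 0)) := by
  -- The two sums differ by the telescoping sum of `d`, which closes up around the cycle. Each
  -- maximal run of vertices satisfying `c` is entered and left through a half of value `x / 2`; the
  -- couple is booked where the run ends.
  let d : ℕ → ℝ := fun k => if c k then (W k + x) / 2 else 0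
  have h1 := Finset.sum_range_sub d n
  have h2 : d n = d 0 := by simp only [d, hc, hW]
  rw [h2, sub_self] at h1
  rw [← sub_eq_zero, ← Finset.sum_sub_distrib, ← h1]
  refine Finset.sum_congr rfl fun k hk => ?_
  have hk := Finset.mem_range.1 hk
  have hSk := hS k hk
  have hx1 := hx k hk.le
  have hx2 := hx (k + 1) hk
  by_cases h1 : c k <;> by_cases h2 : c (k + 1) <;> simp [d, h1, h2] at * <;> linarith

/-- All the vertices of an optimal polygon are on the outer circle. -/
lemma norm_vertex_eq {a b lam : ℝ} (ha : 0 < a) (hab : a < b) (hlam0 : 0 < lam) (hlam : lam ≤ 1 / b)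
    {n : ℕ} {r θ : ℕ → ℝ} (h : ConvexCycle n fun k => pt (r k) (θ k))
    (hopt : IsOptimal a b lam (polygon n fun k => pt (r k) (θ k)))
    (hr : ∀ k ≤ n, 0 < r k) (hrn : r n = r 0) (hθn : θ n = θ 0 + 2 * Real.pi)
    (hθ : ∀ k < n, θ k < θ (k + 1) ∧ θ (k + 1) < θ k + Real.pi) : ∀ k ≤ n, r k = b := by
  have hb := ha.trans hab
  have hpi := Real.pi_pos
  have hin := (h.closedBall_subset_iff ha.le).1 hopt.1.2.1
  have hrb : ∀ k ≤ n, r k ≤ b := fun k hk => by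
    rw [← norm_pt (hr k hk).le (θ k)]
    simpa using hopt.1.2.2 (h.mem_polygon hk)
  -- A vertex on the inner circle would have both its sides perpendicular to its radius, hence
  -- aligned.
  have hra : ∀ k ≤ n, r k < b → a < r k := by
    intro k hk hkb
    wlog hkn : k < n generalizing k
    · obtain rfl : k = n := by omega
      rw [hrn] at hkb ⊢
      exact this 0 (by omega) hkb h.pos_n
    have hge : a ≤ r k := by
      have h1 := hin k hkn
      have h2 := abs_cross_le (pt (r k) (θ k)) (pt (r (k + 1)) (θ (k + 1)) - pt (r k) (θ k))
      have h3 : cross (pt (r k) (θ k)) (pt (r (k + 1)) (θ (k + 1)) - pt (r k) (θ k)) =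
        cross (pt (r k) (θ k)) (pt (r (k + 1)) (θ (k + 1))) := by simp [cross]; ring
      have hpos : 0 < ‖pt (r (k + 1)) (θ (k + 1)) - pt (r k) (θ k)‖ :=
        norm_pos_iff.2 (sub_ne_zero.2 (h.apply_succ_ne hkn))
      rw [h3, norm_pt (hr k hk).le] at h2
      exact le_of_mul_le_mul_right (h1.trans ((le_abs_self _).trans h2)) hpos
    refine lt_of_le_of_ne hge fun hea => ?_
    obtain ⟨j, hj, hjk⟩ : ∃ j < n, (j + 1) % n = k := by
      rcases Nat.eq_zero_or_pos k with rfl | h0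
      · exact ⟨n - 1, by omega, by rw [show n - 1 + 1 = n by omega, Nat.mod_self]⟩
      · exact ⟨k - 1, by omega, by rw [show k - 1 + 1 = k by omega, Nat.mod_eq_of_lt hkn]⟩
    have hvj : pt (r (j + 1)) (θ (j + 1)) = pt (r k) (θ k) := by rw [← hjk]; exact (h.apply_mod hj).symm
    have hjk' : j ≠ k := fun e => h.succ_mod_ne hj (by omega)
    have hPn : ‖pt (r k) (θ k)‖ = a := by rw [norm_pt (hr k hk).le, hea]
    have t1 := side_tangent_of_norm_lt h ha.le hopt hkn (Or.inl (by rwa [norm_pt (hr k hk).le]))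
    have t2 := side_tangent_of_norm_lt h ha.le hopt hj (Or.inr (by
      rwa [hvj, norm_pt (hr k hk).le]))
    have hpos : 0 < orient (pt (r j) (θ j)) (pt (r k) (θ k)) (pt (r (k + 1)) (θ (k + 1))) := by
      rcases h.orient_side_pos_or hj hkn hjk' with hp | hp
      · rw [hvj, orient_self_right] at hp; exact absurd hp (lt_irrefl _)
      · rwa [hvj] at hp
    simp only [hvj] at t1 t2
    generalize pt (r k) (θ k) = P at *
    generalize pt (r j) (θ j) = A at *
    generalize pt (r (k + 1)) (θ (k + 1)) = B at *
    have n1 := norm_sq_plane (B - P)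
    have n2 := norm_sq_plane (P - A)
    have n3 := norm_sq_plane P
    -- Lagrange's identity: equality in the bound of the determinant by the product of the norms
    -- means orthogonality.
    have i1 : inner ℝ P (B - P) = 0 := by
      have q : (a * ‖B - P‖) ^ 2 = cross P B ^ 2 := by rw [t1]
      rw [mul_pow, ← hPn, n1, n3] at q
      rw [inner_plane]
      simp only [PiLp.sub_apply, cross] at q ⊢
      rw [← sq_eq_zero_iff]
      linear_combination q
    have i2 : inner ℝ P (P - A) = 0 := by
      have q : (a * ‖P - A‖) ^ 2 = cross A P ^ 2 := by rw [t2]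
      rw [mul_pow, ← hPn, n2, n3] at q
      rw [inner_plane]
      simp only [PiLp.sub_apply, cross] at q ⊢
      rw [← sq_eq_zero_iff]
      linear_combination q
    have : a ^ 2 * orient A P B = 0 := by
      rw [← hPn, n3]
      rw [inner_plane] at i1 i2
      simp only [PiLp.sub_apply] at i1 i2
      unfold orient
      linear_combination (P 0 * (B 1 - P 1) - P 1 * (B 0 - P 0)) * i2
        - (P 0 * (P 1 - A 1) - P 1 * (P 0 - A 0)) * i1
    have h5 := mul_pos (pow_pos ha 2) hpos
    linarith
  by_contra! hcon
  obtain ⟨m, hm, hmb⟩ := hcon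
  obtain ⟨m, hm, hmb⟩ : ∃ m < n, r m < b := by
    rcases hm.lt_or_eq with hm' | rfl
    · exact ⟨m, hm', lt_of_le_of_ne (hrb m hm) hmb⟩
    · exact ⟨0, h.pos_n, lt_of_le_of_ne (hrb 0 (Nat.zero_le _)) (by rwa [← hrn])⟩
  classical
  let c : ℕ → Prop := fun k => r k < b
  let ω : ℕ → ℝ := fun k => Real.arccos (a / r k)
  have hωn : ω n = ω 0 := by simp only [ω, hrn]
  have hcn : c n ↔ c 0 := by simp only [c, hrn]
  have hωO : ∀ k ≤ n, ¬ c k → ω k = xi0 a b := by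
    intro k hk hck
    have : r k = b := le_antisymm (hrb k hk) (not_lt.1 hck)
    simp only [ω, this, xi0]
  have htan : ∀ k < n, c k ∨ c (k + 1) → θ (k + 1) - θ k = ω k + ω (k + 1) ∧
      lam / 2 * cross (pt (r k) (θ k)) (pt (r (k + 1)) (θ (k + 1))) -
        ‖pt (r (k + 1)) (θ (k + 1)) - pt (r k) (θ k)‖ =
      (kiteJ a lam (ω k) + kiteJ a lam (ω (k + 1))) / 2 := by
    intro k hk hck
    have ht := side_tangent_of_norm_lt h ha.le hopt hk (by
      rw [norm_pt (hr k hk.le).le, norm_pt (hr (k + 1) hk).le]; exact hck)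
    have hne := (h.apply_succ_ne hk).symm
    have hf := hopt.1.2.1 (mem_closedBall_zero_iff.2 (norm_foot ha.le hne).le)
    have hf' := h.mem_side_of_orient_eq_zero hf hk (by rw [orient_foot hne]; linarith)
    obtain ⟨h1, h2⟩ := tangent_side ha (hr k hk.le) (hr (k + 1) hk) (hθ k hk).1 (hθ k hk).2 hf'
    refine ⟨h1, ?_⟩
    rw [← ht, h2, kiteJ, kiteJ]; ring
  have hsumθ : ∑ k ∈ Finset.range n, (θ (k + 1) - θ k) / 2 = Real.pi := by
    rw [← Finset.sum_div, Finset.sum_range_sub, hθn]; ring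
  have hsum := sum_regroup c hcn (fun k => (θ (k + 1) - θ k) / 2) ω (xi0 a b) hωn hωO
    (fun k hk hck => by rw [(htan k hk hck).1])
  have hJ := sum_regroup c hcn (fun k => lam / 2 * cross (pt (r k) (θ k)) (pt (r (k + 1)) (θ (k + 1))) -
        ‖pt (r (k + 1)) (θ (k + 1)) - pt (r k) (θ k)‖) (fun k => kiteJ a lam (ω k))
    (kiteJ a lam (xi0 a b)) (by simp only [hωn]) (fun k hk hck => by rw [hωO k hk hck])
    (fun k hk hck => (htan k hk hck).2)
  have hωI : ∀ k < n, c k → 0 < ω k ∧ ω k < Real.pi / 2 ∧ a < b * Real.cos (ω k) := by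
    intro k hk hck
    have hrk := hr k hk.le
    have h1 := hra k hk.le hck
    have hlt : a / r k < 1 := (div_lt_one hrk).2 h1
    have hpos : 0 < a / r k := by positivity
    refine ⟨Real.arccos_pos.2 hlt, Real.arccos_lt_pi_div_two.2 hpos, ?_⟩
    simp only [ω]
    rw [Real.cos_arccos (by linarith) hlt.le, mul_div_assoc', lt_div_iff₀ hrk]
    have : r k < b := hck
    nlinarith
  have hxi := xi0_pos ha hab
  -- Angles of the competitor, three slots per index: a side with both ends on the outer circle is
  -- kept, a kite at an inner vertex becomes a chord of the same angle, and two left-over halves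
  -- become one tangent chord. Unused slots are zero.
  let η : ℕ × Fin 3 → ℝ := fun i => ![if c i.1 ∨ c (i.1 + 1) then 0 else (θ (i.1 + 1) - θ i.1) / 2,
    if c i.1 then ω i.1 else 0, if c i.1 ∧ ¬ c (i.1 + 1) then xi0 a b else 0] i.2
  have hOO : ∀ k < n, ¬ (c k ∨ c (k + 1)) → r k = b ∧ r (k + 1) = b := by
    intro k hk hck
    rw [not_or] at hck
    exact ⟨le_antisymm (hrb k hk.le) (not_lt.1 hck.1), le_antisymm (hrb _ hk) (not_lt.1 hck.2)⟩
  obtain ⟨K, hK, hJK⟩ := exists_admissible_of_family lam ha hab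
    (Finset.range n ×ˢ (Finset.univ : Finset (Fin 3))) (η := η) (by
      rintro ⟨k, i⟩ hi
      have hk : k < n := by simpa using hi
      have := (hθ k hk).1
      fin_cases i
      · show 0 ≤ if c k ∨ c (k + 1) then 0 else (θ (k + 1) - θ k) / 2
        split_ifs <;> linarith
      · show 0 ≤ if c k then ω k else 0
        split_ifs with hck
        · exact (hωI k hk hck).1.le
        · exact le_rfl
      · show 0 ≤ if c k ∧ ¬ c (k + 1) then xi0 a b else 0
        split_ifs <;> linarith) (by
      rintro ⟨k, i⟩ hi
      have hk : k < n := by simpa using hi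
      have hθk := hθ k hk
      fin_cases i
      · show (if c k ∨ c (k + 1) then 0 else (θ (k + 1) - θ k) / 2) ≤ xi0 a b
        split_ifs with hck
        · exact hxi.le
        · obtain ⟨e1, e2⟩ := hOO k hk hck
          have h1 := hin k hk
          simp only [e1, e2] at h1
          rw [norm_chord hb.le hθk.1.le (by linarith), cross_pt] at h1
          have hs : 0 < Real.sin ((θ (k + 1) - θ k) / 2) :=
            Real.sin_pos_of_pos_of_lt_pi (by linarith) (by linarith)
          rw [le_xi0_iff ha hab (by linarith) (by linarith)]
          rw [show θ (k + 1) - θ k = 2 * ((θ (k + 1) - θ k) / 2) by ring, Real.sin_two_mul,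
            mul_div_cancel_left₀ _ two_ne_zero] at h1
          refine le_of_mul_le_mul_left ?_ (mul_pos hb hs)
          linarith
      · show (if c k then ω k else 0) ≤ xi0 a b
        split_ifs with hck
        · obtain ⟨h1, h2, h3⟩ := hωI k hk hck
          exact (le_xi0_iff ha hab h1.le (by linarith)).2 h3.le
        · exact hxi.le
      · show (if c k ∧ ¬ c (k + 1) then xi0 a b else 0) ≤ xi0 a b
        split_ifs <;> linarith) (by
      rw [Finset.sum_product, ← hsumθ, hsum]
      refine Finset.sum_congr rfl fun k _ => ?_
      rw [Fin.sum_univ_three]; rfl)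
  have hle := hopt.2 K hK
  rw [hJK, h.J_polygon, hJ, Finset.sum_product] at hle
  have hz : chordJ b lam 0 = 0 := by simp [chordJ]
  have h0 : ∀ k < n, chordJ b lam (η (k, 0)) = if c k ∨ c (k + 1) then 0 else
      lam / 2 * cross (pt (r k) (θ k)) (pt (r (k + 1)) (θ (k + 1))) -
        ‖pt (r (k + 1)) (θ (k + 1)) - pt (r k) (θ k)‖ := by
    intro k hk
    show chordJ b lam (if c k ∨ c (k + 1) then 0 else (θ (k + 1) - θ k) / 2) = _
    by_cases hck : c k ∨ c (k + 1)
    · rw [if_pos hck, if_pos hck, hz]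
    · obtain ⟨e1, e2⟩ := hOO k hk hck
      have := hθ k hk
      rw [if_neg hck, if_neg hck, e1, e2, chordJ_term hb.le this.1.le (by linarith)]
  have h2 : ∀ k, chordJ b lam (η (k, 2)) =
      if c k ∧ ¬ c (k + 1) then kiteJ a lam (xi0 a b) else 0 := by
    intro k
    show chordJ b lam (if c k ∧ ¬ c (k + 1) then xi0 a b else 0) = _
    split_ifs
    · exact chordJ_xi0 lam ha hab
    · exact hz
  have h1 : ∀ k, chordJ b lam (η (k, 1)) = if c k then chordJ b lam (ω k) else 0 := by
    intro k
    show chordJ b lam (if c k then ω k else 0) = _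
    split_ifs
    · rfl
    · exact hz
  have hlt : ∀ k < n, c k → chordJ b lam (ω k) < kiteJ a lam (ω k) := by
    intro k hk hck
    obtain ⟨p1, p2, p3⟩ := hωI k hk hck
    exact chordJ_lt_kiteJ ha hab hlam0 hlam p1 p2 p3
  refine absurd hle (not_le.2 (Finset.sum_lt_sum (fun k hk => ?_)
    ⟨m, Finset.mem_range.2 hm, ?_⟩))
  · have hk := Finset.mem_range.1 hk
    rw [Fin.sum_univ_three, h0 k hk, h1, h2]
    gcongr
    split_ifs with hck
    · exact (hlt k hk hck).le
    · exact le_rfl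
  · have hcm : c m := hmb
    rw [Fin.sum_univ_three, h0 m hm, h1, h2]
    gcongr
    rw [if_pos hcm, if_pos hcm]
    exact hlt m hm hcm

/-! ### First and second order conditions for minimal families of angles -/

/-- The derivative of `chordJ`. -/
noncomputable def chordJ' (b lam η : ℝ) : ℝ :=
  b * (lam * b * (2 * Real.cos η ^ 2 - 1) - 2 * Real.cos η)

/-- The second derivative of `chordJ`. -/
noncomputable def chordJ'' (b lam η : ℝ) : ℝ := 2 * b * Real.sin η * (1 - 2 * (lam * b) * Real.cos η)

lemma hasDerivAt_chordJ (b lam η : ℝ) : HasDerivAt (chordJ b lam) (chordJ' b lam η) η := by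
  have h := ((Real.hasDerivAt_sin η).const_mul b).mul
    (((Real.hasDerivAt_cos η).const_mul (lam * b)).sub_const 2)
  convert! h using 1
  rw [chordJ']
  linear_combination lam * b ^ 2 * Real.sin_sq_add_cos_sq η

lemma hasDerivAt_chordJ' (b lam η : ℝ) : HasDerivAt (chordJ' b lam) (chordJ'' b lam η) η := by
  have h := ((((((Real.hasDerivAt_cos η).pow 2).const_mul 2).sub_const 1).const_mul (lam * b)).sub
    ((Real.hasDerivAt_cos η).const_mul 2)).const_mul b
  convert! h using 1
  rw [chordJ'']
  push_cast
  ring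

/-- With a negative second derivative the point would also be a local maximum; the function would be
locally constant and its second derivative zero. -/
lemma second_deriv_nonneg_of_isLocalMin {G G' : ℝ → ℝ} {G'' x : ℝ}
    (h1 : ∀ t, HasDerivAt G (G' t) t) (h2 : HasDerivAt G' G'' x) (hmin : IsLocalMin G x) :
    0 ≤ G'' := by
  by_contra! hneg
  have hd : deriv G = G' := funext fun t => (h1 t).deriv
  have hmax : IsLocalMax G x := isLocalMax_of_deriv_deriv_neg (by rwa [hd, h2.deriv])
    (hmin.deriv_eq_zero) (h1 x).continuousAt
  have hconst : G =ᶠ[𝓝 x] fun _ => G x := by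
    filter_upwards [hmin, hmax] with t ht1 ht2 using le_antisymm ht2 ht1
  have h3 := hconst.deriv.deriv_eq
  rw [hd, h2.deriv] at h3
  simp at h3
  linarith

/-- A family of chord angles which is minimal among the inscribed polygons. -/
structure IsMinimalFamily (a b lam : ℝ) (n : ℕ) (η : ℕ → ℝ) : Prop where
  pos : ∀ k < n, 0 < η k
  le : ∀ k < n, η k ≤ xi0 a b
  sum_eq : ∑ k ∈ Finset.range n, η k = Real.pi
  minimal : ∀ ζ : ℕ → ℝ, (∀ k < n, 0 ≤ ζ k) → (∀ k < n, ζ k ≤ xi0 a b) →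
    ∑ k ∈ Finset.range n, ζ k = Real.pi →
    ∑ k ∈ Finset.range n, chordJ b lam (η k) ≤ ∑ k ∈ Finset.range n, chordJ b lam (ζ k)

namespace IsMinimalFamily

variable {a b lam : ℝ} {n : ℕ} {η : ℕ → ℝ} (h : IsMinimalFamily a b lam n η)

include h

/-- Only angles in the open interval `(0, ξ₀)` are perturbed, so small variations of either sign
remain admissible. -/
lemma isLocalMin {w : ℕ → ℝ} (hw : ∑ k ∈ Finset.range n, w k = 0)
    (hw0 : ∀ k < n, η k = xi0 a b → w k = 0) :
    IsLocalMin (fun t : ℝ => ∑ k ∈ Finset.range n, chordJ b lam (η k + t * w k)) 0 := by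
  have e : ∀ᶠ t : ℝ in 𝓝 0, ∀ k ∈ Set.Iio n, 0 ≤ η k + t * w k ∧ η k + t * w k ≤ xi0 a b := by
    rw [eventually_all_finite (Set.finite_Iio n)]
    intro k hk
    have hc : Continuous fun t : ℝ => η k + t * w k := by fun_prop
    have h1 := (hc.tendsto 0).eventually (lt_mem_nhds (a := 0) (by simpa using h.pos k hk))
    rcases (h.le k hk).lt_or_eq with hlt | heq
    · have h2 := (hc.tendsto 0).eventually (isOpen_Iio.mem_nhds (s := Set.Iio (xi0 a b)) (by simpa using hlt))
      filter_upwards [h1, h2] with t ht1 ht2 using ⟨ht1.le, (Set.mem_Iio.1 ht2).le⟩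
    · filter_upwards [h1] with t ht1
      exact ⟨ht1.le, by rw [hw0 k hk heq, heq]; simp⟩
  filter_upwards [e] with t ht
  have := h.minimal (fun k => η k + t * w k) (fun k hk => (ht k hk).1) (fun k hk => (ht k hk).2)
    (by rw [Finset.sum_add_distrib, ← Finset.mul_sum, hw, h.sum_eq]; simp)
  simpa using this

lemma first_order {w : ℕ → ℝ} (hw : ∑ k ∈ Finset.range n, w k = 0)
    (hw0 : ∀ k < n, η k = xi0 a b → w k = 0) :
    ∑ k ∈ Finset.range n, w k * chordJ' b lam (η k) = 0 := by
  have hd : ∀ t : ℝ, HasDerivAt (fun t : ℝ => ∑ k ∈ Finset.range n, chordJ b lam (η k + t * w k))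
      (∑ k ∈ Finset.range n, chordJ' b lam (η k + t * w k) * w k) t := by
    intro t
    refine HasDerivAt.fun_sum fun k _ => ?_
    have h1 : HasDerivAt (fun t : ℝ => η k + t * w k) (w k) t := by
      simpa using ((hasDerivAt_id t).mul_const (w k)).const_add (η k)
    exact (hasDerivAt_chordJ b lam _).comp t h1
  have := (h.isLocalMin hw hw0).hasDerivAt_eq_zero (hd 0)
  simpa [mul_comm] using this

lemma second_order {w : ℕ → ℝ} (hw : ∑ k ∈ Finset.range n, w k = 0)
    (hw0 : ∀ k < n, η k = xi0 a b → w k = 0) :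
    0 ≤ ∑ k ∈ Finset.range n, w k ^ 2 * chordJ'' b lam (η k) := by
  have h1 : ∀ k, ∀ t : ℝ, HasDerivAt (fun t : ℝ => η k + t * w k) (w k) t := fun k t => by
    simpa using ((hasDerivAt_id t).mul_const (w k)).const_add (η k)
  have hd : ∀ t : ℝ, HasDerivAt (fun t : ℝ => ∑ k ∈ Finset.range n, chordJ b lam (η k + t * w k))
      (∑ k ∈ Finset.range n, chordJ' b lam (η k + t * w k) * w k) t := fun t =>
    HasDerivAt.fun_sum fun k _ => (hasDerivAt_chordJ b lam _).comp t (h1 k t)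
  have hd' : HasDerivAt (fun t : ℝ => ∑ k ∈ Finset.range n, chordJ' b lam (η k + t * w k) * w k)
      (∑ k ∈ Finset.range n, chordJ'' b lam (η k + 0 * w k) * w k * w k) 0 :=
    HasDerivAt.fun_sum fun k _ => ((hasDerivAt_chordJ' b lam _).comp 0 (h1 k 0)).mul_const (w k)
  have := second_deriv_nonneg_of_isLocalMin hd hd' (h.isLocalMin hw hw0)
  refine this.trans_eq (Finset.sum_congr rfl fun k _ => ?_)
  rw [zero_mul, add_zero]; ring

omit h in
lemma sum_pair {i j : ℕ} (hi : i < n) (hj : j < n) (hij : i ≠ j) {g : ℕ → ℝ}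
    (hg : ∀ k, k ≠ i → k ≠ j → g k = 0) : ∑ k ∈ Finset.range n, g k = g i + g j :=
  Finset.sum_eq_add_of_mem i j (Finset.mem_range.2 hi) (Finset.mem_range.2 hj) hij
    fun k _ hk => hg k hk.1 hk.2

/-- Test with the transfer of angle from `j` to `i`. -/
lemma chordJ'_eq {i j : ℕ} (hi : i < n) (hj : j < n) (hij : i ≠ j) (hi' : η i < xi0 a b)
    (hj' : η j < xi0 a b) :
    chordJ' b lam (η i) = chordJ' b lam (η j) ∧
      0 ≤ chordJ'' b lam (η i) + chordJ'' b lam (η j) := by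
  let w : ℕ → ℝ := fun k => if k = i then 1 else if k = j then -1 else 0
  have wi : w i = 1 := by simp [w]
  have wj : w j = -1 := by simp [w, hij.symm]
  have w0 : ∀ k, k ≠ i → k ≠ j → w k = 0 := fun k h1 h2 => by simp [w, h1, h2]
  have hw : ∑ k ∈ Finset.range n, w k = 0 := by rw [sum_pair hi hj hij w0, wi, wj]; ring
  have hw0 : ∀ k < n, η k = xi0 a b → w k = 0 := fun k _ hk =>
    w0 k (by rintro rfl; exact hi'.ne hk) (by rintro rfl; exact hj'.ne hk)
  constructor
  · have := h.first_order hw hw0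
    rw [sum_pair hi hj hij (fun k h1 h2 => by rw [w0 k h1 h2, zero_mul]), wi, wj] at this
    linarith
  · have := h.second_order hw hw0
    rw [sum_pair hi hj hij (fun k h1 h2 => by rw [w0 k h1 h2]; ring), wi, wj] at this
    linarith

end IsMinimalFamily

/-! ### The angles `x₀` and `x₁` and trigonometric estimates -/

lemma cos_x0 {b lam : ℝ} (hμ : 1 / 2 < lam * b) : Real.cos (x0 b lam) = 1 / (2 * (lam * b)) := by
  rw [x0, mul_assoc]
  have : 0 < 1 / (2 * (lam * b)) := by positivity
  exact Real.cos_arccos (by linarith) ((div_le_one (by linarith)).2 (by linarith))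

lemma x0_pos {b lam : ℝ} (hμ : 1 / 2 < lam * b) : 0 < x0 b lam := by
  rw [x0, mul_assoc]
  exact Real.arccos_pos.2 ((div_lt_one (by linarith)).2 (by linarith))

lemma cos_x1 {b lam : ℝ} (hμ : 1 / 2 < lam * b) (hμ1 : lam * b ≤ 1) :
    Real.cos (x1 b lam) = 1 / (lam * b) - 1 := by
  have h1 : 1 ≤ 1 / (lam * b) := (one_le_div (by linarith)).2 hμ1
  have h2 : 1 / (lam * b) ≤ 2 := (div_le_iff₀ (by linarith)).2 (by linarith)
  exact Real.cos_arccos (by linarith) (by linarith)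

lemma x1_le {b lam : ℝ} (hμ : 1 / 2 < lam * b) (hμ1 : lam * b ≤ 1) : x1 b lam ≤ Real.pi / 2 := by
  have h1 : 1 ≤ 1 / (lam * b) := (one_le_div (by linarith)).2 hμ1
  exact Real.arccos_le_pi_div_two.2 (by linarith)

lemma x1_nonneg (b lam : ℝ) : 0 ≤ x1 b lam := Real.arccos_nonneg _

/-- `x0` is the inflection point of `chordJ`: the second derivative vanishes where `2 * (lam * b) *
cos η = 1`. -/
lemma chordJ''_neg {b lam η : ℝ} (hb : 0 < b) (hμ : 1 / 2 < lam * b) (h0 : 0 < η)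
    (h1 : η < x0 b lam) : chordJ'' b lam η < 0 := by
  have hpi : x0 b lam ≤ Real.pi := Real.arccos_le_pi _
  have hc := Real.cos_lt_cos_of_nonneg_of_le_pi h0.le hpi h1
  rw [cos_x0 hμ, div_lt_iff₀ (by linarith)] at hc
  have hs := Real.sin_pos_of_pos_of_lt_pi h0 (by linarith)
  rw [chordJ'']
  exact mul_neg_of_pos_of_neg (by positivity) (by linarith)

/-- Beyond `x0`, averaging two chord angles decreases the functional. -/
lemma chordJ_midpoint_lt {b lam m d : ℝ} (hb : 0 < b) (hμ : 1 / 2 < lam * b) (hd : 0 < d)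
    (h0 : x0 b lam ≤ m - d) (h1 : m + d ≤ Real.pi) :
    2 * chordJ b lam m < chordJ b lam (m - d) + chordJ b lam (m + d) := by
  have hx := x0_pos hμ
  have c1 := Real.cos_le_cos_of_nonneg_of_le_pi hx.le (by linarith) h0
  have c2 := Real.cos_lt_cos_of_nonneg_of_le_pi hx.le (by linarith) (show x0 b lam < m by linarith)
  have c3 := Real.cos_lt_cos_of_nonneg_of_le_pi hx.le h1 (show x0 b lam < m + d by linarith)
  have cd : Real.cos d < 1 := by
    have := Real.cos_lt_cos_of_nonneg_of_le_pi le_rfl (by linarith) hd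
    rwa [Real.cos_zero] at this
  have hs := Real.sin_pos_of_pos_of_lt_pi (show 0 < m by linarith) (by linarith)
  have hμ0 : 0 < lam * b := by linarith
  have hx0 := cos_x0 hμ
  rw [eq_div_iff (by positivity)] at hx0
  rw [Real.cos_add] at c3
  rw [Real.cos_sub] at c1
  -- `cos m * cos d` is the average of `cos (m - d)` and `cos (m + d)`, so it is below `cos x0`, as
  -- `cos m` is; and `2 * (lam * b) * cos x0 = 1`.
  have key : lam * b * (Real.cos m * (Real.cos d + 1)) < 1 := by nlinarith
  have hpos : 0 < 4 * b * Real.sin m * ((1 - Real.cos d) *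
      (1 - lam * b * (Real.cos m * (Real.cos d + 1)))) :=
    mul_pos (by positivity) (mul_pos (by linarith) (by linarith))
  simp only [chordJ, Real.sin_add, Real.sin_sub, Real.cos_add, Real.cos_sub]
  have hsd := Real.sin_sq_add_cos_sq d
  have e : b * (Real.sin m * Real.cos d - Real.cos m * Real.sin d) *
        (lam * b * (Real.cos m * Real.cos d + Real.sin m * Real.sin d) - 2) +
      b * (Real.sin m * Real.cos d + Real.cos m * Real.sin d) *
        (lam * b * (Real.cos m * Real.cos d - Real.sin m * Real.sin d) - 2) -
      2 * (b * Real.sin m * (lam * b * Real.cos m - 2)) =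
      4 * b * Real.sin m * ((1 - Real.cos d) *
      (1 - lam * b * (Real.cos m * (Real.cos d + 1)))) := by
    linear_combination (-2 * lam * b ^ 2 * Real.sin m * Real.cos m) * hsd
  linarith

/-- Mean value theorem, with the sine increasing on `[0, π / 2]`. -/
lemma cos_sub_cos_bounds {u v : ℝ} (h0 : 0 ≤ u) (huv : u < v) (hv : v ≤ Real.pi / 2) :
    (v - u) * Real.sin u ≤ Real.cos u - Real.cos v ∧
      Real.cos u - Real.cos v ≤ (v - u) * Real.sin v := by
  obtain ⟨c, ⟨hc1, hc2⟩, hc⟩ := exists_hasDerivAt_eq_slope Real.cos (fun x => -Real.sin x) huv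
    Real.continuous_cos.continuousOn fun x _ => Real.hasDerivAt_cos x
  rw [eq_div_iff (by linarith)] at hc
  have hpi := Real.pi_pos
  have s1 : Real.sin u ≤ Real.sin c :=
    Real.sin_le_sin_of_le_of_le_pi_div_two (by linarith) (by linarith) hc1.le
  have s2 : Real.sin c ≤ Real.sin v :=
    Real.sin_le_sin_of_le_of_le_pi_div_two (by linarith) hv hc2.le
  constructor <;> nlinarith

/-- `1 - cos x = 2 sin² (x / 2)`, and `sin (x / 2) ≥ x / 3` in this range. The constant `9 / 2` of
the final bounds stems from here. -/
lemma two_ninths_sq_le {x : ℝ} (h0 : 0 < x) (h1 : x ≤ 2) : 2 / 9 * x ^ 2 ≤ 1 - Real.cos x := by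
  have hs := Real.sin_gt_sub_cube (x := x / 2) (by linarith)
  have hx : x ^ 2 ≤ 4 := by nlinarith
  have h3 : x / 3 ≤ Real.sin (x / 2) := by nlinarith [mul_nonneg h0.le (sub_nonneg.2 hx)]
  have h4 : Real.cos x = 1 - 2 * Real.sin (x / 2) ^ 2 := by
    rw [Real.sin_sq, show x = 2 * (x / 2) by ring, Real.cos_two_mul]; ring_nf
  nlinarith

/-! ### Counting the angles of a minimal family -/

/-- The indices of the angles smaller than `ξ`. -/
def smallIdx (n : ℕ) (η : ℕ → ℝ) (ξ : ℝ) [DecidablePred fun k => η k < ξ] : Finset ℕ :=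
  (Finset.range n).filter fun k => η k < ξ

/-- The indices of the angles equal to `ξ`. -/
def tangentIdx (n : ℕ) (η : ℕ → ℝ) (ξ : ℝ) [DecidablePred fun k => η k = ξ] : Finset ℕ :=
  (Finset.range n).filter fun k => η k = ξ

/-- The consequences of the first and second order conditions when there are two distinct
chord angles `α < β`. -/
lemma two_angle_bounds {b lam α β : ℝ} {N : ℕ} (hμ : 1 / 2 < lam * b) (hμ1 : lam * b ≤ 1)
    (hN : 1 ≤ N) (hα : 0 < α) (hαx : α < x0 b lam) (hβx : x0 b lam < β)
    (hβπ : β < Real.pi / 2) (hcos : lam * b * (Real.cos α + Real.cos β) = 1)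
    (hsin : N * Real.sin α ≤ Real.sin β) (hsum : α + N * β = Real.pi) :
    0 ≤ Real.pi ^ 2 - 9 / 2 * x1 b lam ∧
      (Real.pi + Real.sqrt (Real.pi ^ 2 - 9 / 2 * x1 b lam)) / (2 * x1 b lam) ≤ N ∧
      N * x1 b lam ≤ Real.pi := by
  have hpi := Real.pi_gt_three
  have hN' : (1 : ℝ) ≤ N := by exact_mod_cast hN
  have hx1 := x1_le hμ hμ1
  have hx1' := x1_nonneg b lam
  have hμ0 : 0 < lam * b := by linarith
  -- `x1` is the partner that stationarity would assign to the angle zero: `lam * b * (1 + cos x1) =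
  -- 1`.
  have hc1 : Real.cos (x1 b lam) = Real.cos α + Real.cos β - 1 := by
    have : 1 / (lam * b) = Real.cos α + Real.cos β := by
      rw [div_eq_iff hμ0.ne']; linarith
    rw [cos_x1 hμ hμ1, this]
  have hα1 : Real.cos α < 1 := by
    have := Real.cos_lt_cos_of_nonneg_of_le_pi le_rfl (by linarith) hα
    rwa [Real.cos_zero] at this
  have hβ1 : β < x1 b lam := by
    by_contra! hle
    have := Real.cos_le_cos_of_nonneg_of_le_pi hx1' (by linarith) hle
    linarith
  have hsβ : 0 < Real.sin β := Real.sin_pos_of_pos_of_lt_pi (by linarith) (by linarith)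
  obtain ⟨b1, b2⟩ := cos_sub_cos_bounds (by linarith) hβ1 hx1
  obtain ⟨-, b3⟩ := cos_sub_cos_bounds le_rfl hα (by linarith)
  rw [Real.cos_zero, sub_zero] at b3
  have hs1 := Real.sin_le_one (x1 b lam)
  have hd : 1 - Real.cos α ≤ x1 b lam - β := by nlinarith
  -- `N (x1 - β) sin β ≤ N (cos β - cos x1) = N (1 - cos α) ≤ N α sin α ≤ α sin β`.
  have hup : N * (x1 b lam - β) ≤ α := by
    refine le_of_mul_le_mul_right ?_ hsβ
    nlinarith
  have hlow := two_ninths_sq_le hα (by linarith [Real.pi_lt_d2])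
  -- With `s = N α`, the left side is at most `s - 2 / 9 * s ^ 2`, whose maximum `9 / 8` is attained
  -- at `s = 9 / 4`.
  have hquad : N * (Real.pi - N * x1 b lam) ≤ 9 / 8 := by
    have e : N * (Real.pi - N * x1 b lam) = N * α - N ^ 2 * (x1 b lam - β) := by
      rw [← hsum]; ring
    have : (N : ℝ) ^ 2 * (2 / 9 * α ^ 2) ≤ N ^ 2 * (x1 b lam - β) :=
      mul_le_mul_of_nonneg_left (by linarith) (by positivity)
    rw [e]
    nlinarith [sq_nonneg (N * α - 9 / 4)]
  have hrad : 0 ≤ Real.pi ^ 2 - 9 / 2 * x1 b lam := by nlinarith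
  refine ⟨hrad, ?_, by linarith⟩
  have hx1pos : 0 < x1 b lam := by linarith
  rw [div_le_iff₀ (by linarith)]
  -- This selects the larger root of the quadratic: `π = α + N β < (N + 1) x1 ≤ 2 N x1`.
  have hge : 0 ≤ 2 * x1 b lam * N - Real.pi := by nlinarith
  have : Real.sqrt (Real.pi ^ 2 - 9 / 2 * x1 b lam) ≤ 2 * x1 b lam * N - Real.pi := by
    rw [Real.sqrt_le_left hge]
    nlinarith
  linarith

namespace IsMinimalFamily

variable {a b lam : ℝ} {n : ℕ} {η : ℕ → ℝ} (h : IsMinimalFamily a b lam n η)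

include h

open Classical in
lemma sum_smallIdx : ∑ k ∈ smallIdx n η (xi0 a b), η k =
    Real.pi - (tangentIdx n η (xi0 a b)).card * xi0 a b := by
  have h1 := Finset.sum_filter_add_sum_filter_not (Finset.range n) (fun k => η k < xi0 a b) η
  have h2 : (Finset.range n).filter (fun k => ¬ η k < xi0 a b) = tangentIdx n η (xi0 a b) := by
    unfold tangentIdx
    refine Finset.filter_congr fun k hk => ?_
    have := h.le k (Finset.mem_range.1 hk)
    rw [not_lt]
    exact ⟨fun hge => le_antisymm this hge, fun he => he.ge⟩
  have h3 : ∑ k ∈ tangentIdx n η (xi0 a b), η k = (tangentIdx n η (xi0 a b)).card * xi0 a b := by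
    have : ∀ k ∈ tangentIdx n η (xi0 a b), η k = xi0 a b := fun k hk => (Finset.mem_filter.1 hk).2
    rw [Finset.sum_congr rfl this, Finset.sum_const, nsmul_eq_mul]
  rw [h2, h3, h.sum_eq] at h1
  unfold smallIdx
  linarith

/-- Two free angles in the range of strict concavity would violate the second order condition. -/
lemma eq_of_lt_x0 (hb : 0 < b) (hμ : 1 / 2 < lam * b) {i j : ℕ} (hi : i < n) (hj : j < n)
    (hi' : η i < xi0 a b) (hj' : η j < xi0 a b) (hi0 : η i < x0 b lam) (hj0 : η j < x0 b lam) :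
    i = j := by
  by_contra hij
  have := (h.chordJ'_eq hi hj hij hi' hj').2
  have := chordJ''_neg hb hμ (h.pos i hi) hi0
  have := chordJ''_neg hb hμ (h.pos j hj) hj0
  linarith

-- All free angles except at most one are at least `x0`.
open Classical in
lemma card_smallIdx_le (hb : 0 < b) (hμ : 1 / 2 < lam * b) :
    ((smallIdx n η (xi0 a b)).card - 1) * x0 b lam ≤ ∑ k ∈ smallIdx n η (xi0 a b), η k := by
  have hx := x0_pos hμ
  set Q := smallIdx n η (xi0 a b)
  have hQ : ∀ k ∈ Q, k < n ∧ η k < xi0 a b := fun k hk => by simpa [Q, smallIdx] using hk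
  by_cases hex : ∃ i ∈ Q, η i < x0 b lam
  · obtain ⟨i, hi, hi0⟩ := hex
    have h1 : ((Q.erase i).card : ℝ) * x0 b lam ≤ ∑ k ∈ Q.erase i, η k := by
      rw [← nsmul_eq_mul]
      refine Finset.card_nsmul_le_sum _ _ _ fun k hk => ?_
      by_contra! hlt
      obtain ⟨hki, hkQ⟩ := Finset.mem_erase.1 hk
      exact hki (h.eq_of_lt_x0 hb hμ (hQ k hkQ).1 (hQ i hi).1 (hQ k hkQ).2 (hQ i hi).2 hlt hi0)
    have h2 := Finset.add_sum_erase Q η hi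
    have h3 : ((Q.erase i).card : ℝ) = Q.card - 1 := by
      rw [Finset.card_erase_of_mem hi, Nat.cast_sub (Finset.card_pos.2 ⟨i, hi⟩)]; simp
    have := h.pos i (hQ i hi).1
    rw [h3] at h1
    linarith
  · push Not at hex
    have h1 : (Q.card : ℝ) * x0 b lam ≤ ∑ k ∈ Q, η k := by
      rw [← nsmul_eq_mul]
      exact Finset.card_nsmul_le_sum _ _ _ hex
    linarith

open Classical in
/-- A family with an angle in `[x0, ξ₀)` has no angle equal to `ξ₀`. -/
lemma tangentIdx_eq_empty (ha : 0 < a) (hab : a < b) (hμ : 1 / 2 < lam * b) {j : ℕ} (hj : j < n)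
    (hj' : η j < xi0 a b) (hjx : x0 b lam ≤ η j) : tangentIdx n η (xi0 a b) = ∅ := by
  have hxi := xi0_lt ha hab
  by_contra hne
  obtain ⟨k, hk⟩ := Finset.nonempty_iff_ne_empty.2 hne
  obtain ⟨hkn, hk⟩ : k < n ∧ η k = xi0 a b := by simpa [tangentIdx] using hk
  have hjk : j ≠ k := by rintro rfl; exact hj'.ne hk
  -- Replacing `η j` and `ξ₀` by two copies of their average keeps the sum of the angles and lowers
  -- the functional.
  let m := (η j + xi0 a b) / 2
  let d := (xi0 a b - η j) / 2
  have hpi := Real.pi_pos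
  have hlt := chordJ_midpoint_lt (lam := lam) (m := m) (d := d) (ha.trans hab) hμ
    (by simp only [d]; linarith) (by simp only [m, d]; linarith) (by simp only [m, d]; linarith)
  rw [show m - d = η j by simp only [m, d]; ring, show m + d = η k by simp only [m, d, hk]; ring]
    at hlt
  have hjpos := h.pos j hj
  let ζ : ℕ → ℝ := fun i => if i = j then m else if i = k then m else η i
  have ζj : ζ j = m := by simp [ζ]
  have ζk : ζ k = m := by simp [ζ]
  have ζo : ∀ i, i ≠ j → i ≠ k → ζ i = η i := fun i h1 h2 => by simp [ζ, h1, h2]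
  have hb : ∀ i < n, 0 ≤ ζ i ∧ ζ i ≤ xi0 a b := by
    intro i hi
    by_cases h1 : i = j
    · rw [h1, ζj]; simp only [m]; constructor <;> linarith
    by_cases h2 : i = k
    · rw [h2, ζk]; simp only [m]; constructor <;> linarith
    · rw [ζo i h1 h2]; exact ⟨(h.pos i hi).le, h.le i hi⟩
  have hdiff : ∀ g : ℝ → ℝ, ∑ i ∈ Finset.range n, g (ζ i) - ∑ i ∈ Finset.range n, g (η i) =
      2 * g m - (g (η j) + g (η k)) := by
    intro g
    rw [← Finset.sum_sub_distrib, sum_pair hj hkn hjk, ζj, ζk]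
    · ring
    · intro i h1 h2; rw [ζo i h1 h2, sub_self]
  have h1 := hdiff fun x => x
  have h2 := hdiff (chordJ b lam)
  have h3 := h.minimal ζ (fun i hi => (hb i hi).1) (fun i hi => (hb i hi).2) (by
    rw [h.sum_eq, hk] at h1
    simp only [m] at h1
    linarith)
  linarith

open Classical in
lemma distinct_bounds (ha : 0 < a) (hab : a < b) (hμ : 1 / 2 < lam * b) (hμ1 : lam * b ≤ 1)
    {i j : ℕ} (hi : i < n) (hj : j < n) (hi' : η i < xi0 a b) (hj' : η j < xi0 a b)
    (hij : η i < η j) :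
    (tangentIdx n η (xi0 a b)).card = 0 ∧
    0 ≤ Real.pi ^ 2 - 9 / 2 * x1 b lam ∧
      (Real.pi + Real.sqrt (Real.pi ^ 2 - 9 / 2 * x1 b lam)) / (2 * x1 b lam) + 1 ≤
        (smallIdx n η (xi0 a b)).card ∧
      ((smallIdx n η (xi0 a b)).card - 1) * x1 b lam ≤ Real.pi := by
  have hb := ha.trans hab
  have hxi := xi0_lt ha hab
  have hpi := Real.pi_pos
  have hμ0 : 0 < lam * b := by linarith
  have crit : ∀ k l, k < n → l < n → η k < xi0 a b → η l < xi0 a b → η k ≠ η l →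
      lam * b * (Real.cos (η k) + Real.cos (η l)) = 1 := by
    intro k l hk hl hk' hl' hne
    have h1 := (h.chordJ'_eq hk hl (fun e => hne (by rw [e])) hk' hl').1
    have h2 : Real.cos (η k) ≠ Real.cos (η l) := fun e => hne
      (Real.injOn_cos ⟨(h.pos k hk).le, by linarith⟩ ⟨(h.pos l hl).le, by linarith⟩ e)
    -- `chordJ'` is quadratic in the cosine, so the difference of two values factors.
    have h3 : 2 * b * ((Real.cos (η k) - Real.cos (η l)) *
        (lam * b * (Real.cos (η k) + Real.cos (η l)) - 1)) = 0 := by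
      unfold chordJ' at h1
      linear_combination h1
    have h4 := (mul_eq_zero.1 ((mul_eq_zero.1 h3).resolve_left (by positivity))).resolve_left
      (sub_ne_zero.2 h2)
    linarith
  have hcos := crit i j hi hj hi' hj' hij.ne
  have hclt := Real.cos_lt_cos_of_nonneg_of_le_pi (h.pos i hi).le (by linarith) hij
  have hx0 := cos_x0 hμ
  rw [eq_div_iff (by positivity)] at hx0
  have hx0pi : x0 b lam ≤ Real.pi := Real.arccos_le_pi _
  have hαx : η i < x0 b lam := by
    by_contra! hle
    have := Real.cos_le_cos_of_nonneg_of_le_pi (x0_pos hμ).le (by linarith) hle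
    nlinarith
  have hβx : x0 b lam < η j := by
    by_contra! hle
    have := Real.cos_le_cos_of_nonneg_of_le_pi (h.pos j hj).le hx0pi hle
    nlinarith
  have hT := h.tangentIdx_eq_empty ha hab hμ hj hj' hβx.le
  set Q := smallIdx n η (xi0 a b)
  have hQ : ∀ k, k ∈ Q ↔ k < n ∧ η k < xi0 a b := fun k => by simp [Q, smallIdx]
  have hiQ : i ∈ Q := (hQ i).2 ⟨hi, hi'⟩
  have hne : i ≠ j := by rintro rfl; exact lt_irrefl _ hij
  have hjQ : j ∈ Q.erase i := Finset.mem_erase.2 ⟨hne.symm, (hQ j).2 ⟨hj, hj'⟩⟩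
  -- A free angle different from `η j` has the same cosine as `η i`, hence lies below `x0`, where
  -- there is room for one index only.
  have hβ : ∀ k ∈ Q.erase i, η k = η j := by
    intro k hk
    obtain ⟨hki, hkQ⟩ := Finset.mem_erase.1 hk
    obtain ⟨hkn, hk'⟩ := (hQ k).1 hkQ
    by_contra hkj
    have h1 := crit k j hkn hj hk' hj' hkj
    have h2 : Real.cos (η k) = Real.cos (η i) := by
      have := mul_left_cancel₀ hμ0.ne' (h1.trans hcos.symm)
      linarith
    have h3 := Real.injOn_cos ⟨(h.pos k hkn).le, by linarith⟩ ⟨(h.pos i hi).le, by linarith⟩ h2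
    exact hki (h.eq_of_lt_x0 hb hμ hkn hi hk' hi' (by rwa [h3]) hαx)
  set N := (Q.erase i).card
  have hN : 1 ≤ N := Finset.card_pos.2 ⟨j, hjQ⟩
  have hcard : (Q.card : ℝ) = N + 1 := by
    have := Finset.card_erase_add_one hiQ
    exact_mod_cast this.symm
  have hsub : Q ⊆ Finset.range n := Finset.filter_subset _ _
  have hsumQ : ∀ g : ℕ → ℝ, (∀ k ∈ Q.erase i, g k = g j) →
      ∑ k ∈ Q, g k = g i + N * g j := by
    intro g hg
    rw [← Finset.add_sum_erase Q g hiQ, Finset.sum_congr rfl hg, Finset.sum_const, nsmul_eq_mul]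
  have hsum : η i + N * η j = Real.pi := by
    have := h.sum_smallIdx
    rw [hT] at this
    simp only [Finset.card_empty, Nat.cast_zero, zero_mul, sub_zero] at this
    rw [← hsumQ η hβ]; exact this
  -- The small angle is traded against all the large ones simultaneously; this direction yields `N
  -- sin α ≤ sin β`.
  let w : ℕ → ℝ := fun k => if k = i then -N else if k ∈ Q then 1 else 0
  have wi : w i = -N := by simp [w]
  have wQ : ∀ k ∈ Q.erase i, w k = 1 := fun k hk => by
    obtain ⟨h1, h2⟩ := Finset.mem_erase.1 hk
    simp [w, h1, h2]
  have w0 : ∀ k, k ∉ Q → w k = 0 := fun k hk => by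
    have : k ≠ i := by rintro rfl; exact hk hiQ
    simp [w, this, hk]
  have hsumw : ∀ g : ℕ → ℝ, (∀ k ∈ Q.erase i, g k = g j) → (∀ k, k ∉ Q → g k = 0) →
      ∑ k ∈ Finset.range n, g k = g i + N * g j := by
    intro g hg hg0
    rw [← hsumQ g hg]
    exact (Finset.sum_subset hsub fun k _ hk => hg0 k hk).symm
  have h2nd := h.second_order (w := w)
    (by rw [hsumw w (fun k hk => by rw [wQ k hk, wQ j hjQ]) w0, wi, wQ j hjQ]; ring)
    (fun k hk hkx => w0 k fun hkQ => ((hQ k).1 hkQ).2.ne hkx)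
  rw [hsumw _ (fun k hk => by rw [wQ k hk, wQ j hjQ, hβ k hk])
    (fun k hk => by rw [w0 k hk]; ring), wi, wQ j hjQ] at h2nd
  have hN0 : (0 : ℝ) < N := by exact_mod_cast hN
  have hsin : N * Real.sin (η i) ≤ Real.sin (η j) := by
    -- By `hcos`, `1 - 2 (lam * b) cos (η j)` is the opposite of `1 - 2 (lam * b) cos (η i)`, so a
    -- common positive factor splits off.
    have e : (-(N : ℝ)) ^ 2 * chordJ'' b lam (η i) + N * (1 ^ 2 * chordJ'' b lam (η j)) =
        (2 * b * N * (2 * (lam * b) * Real.cos (η i) - 1)) *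
          (Real.sin (η j) - N * Real.sin (η i)) := by
      unfold chordJ''
      linear_combination (-4 * b * N * Real.sin (η j)) * hcos
    rw [e] at h2nd
    have hpos : 0 < 2 * b * N * (2 * (lam * b) * Real.cos (η i) - 1) :=
      mul_pos (by positivity) (by nlinarith)
    have := nonneg_of_mul_nonneg_right h2nd hpos
    linarith
  obtain ⟨r1, r2, r3⟩ := two_angle_bounds hμ hμ1 hN (h.pos i hi) hαx hβx (by linarith) hcos hsin hsum
  refine ⟨by rw [hT, Finset.card_empty], r1, ?_, ?_⟩
  · rw [hcard]; linarith
  · rw [hcard]; linarith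

end IsMinimalFamily

/-! ### Sides, contacts and the numbers `p` and `q` of an inscribed polygon -/

lemma midpoint_pt (b θ θ' : ℝ) : midpoint ℝ (pt b θ) (pt b θ') =
    pt (b * Real.cos ((θ' - θ) / 2)) ((θ + θ') / 2) := by
  obtain ⟨m, hm⟩ : ∃ m, m = (θ + θ') / 2 := ⟨_, rfl⟩
  obtain ⟨d, hd⟩ : ∃ d, d = (θ' - θ) / 2 := ⟨_, rfl⟩
  obtain rfl : θ = m - d := by linarith
  obtain rfl : θ' = m + d := by linarith
  rw [← hm, ← hd, midpoint_eq_smul_add]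
  apply plane_ext
  · simp [Real.cos_add, Real.cos_sub]; ring
  · simp [Real.sin_add, Real.sin_sub]; ring

lemma touchesAt_symm {a : ℝ} {P Q T : Plane} (h : TouchesAt a P Q T) : TouchesAt a Q P T := by
  obtain ⟨h1, h2⟩ := h
  exact ⟨by rwa [segment_symm], by rwa [Set.pair_comm]⟩

/-- A chord of a circle centred at the origin can only touch a concentric disc at its midpoint. -/
lemma touchesAt_iff {a : ℝ} {P Q T : Plane} (hn : ‖P‖ = ‖Q‖) (hne : P ≠ Q) :
    TouchesAt a P Q T ↔ T = midpoint ℝ P Q ∧ ‖midpoint ℝ P Q‖ = a := by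
  have hPQ : P 0 ^ 2 + P 1 ^ 2 = Q 0 ^ 2 + Q 1 ^ 2 := by
    rw [← norm_sq_plane, ← norm_sq_plane, hn]
  have hP : P ∈ line[ℝ, P, Q] := left_mem_affineSpan_pair ..
  have hQ : Q ∈ line[ℝ, P, Q] := right_mem_affineSpan_pair ..
  constructor
  · rintro ⟨⟨s, t, -, -, hst, rfl⟩, ht⟩
    have i1 := ht.inner_left_eq_zero_of_mem hP
    have i2 := ht.inner_left_eq_zero_of_mem hQ
    have hs := ht.mem_sphere
    obtain rfl : s = 1 - t := by linarith
    simp only [vsub_eq_sub, sub_zero, inner_plane, PiLp.sub_apply, PiLp.add_apply,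
      PiLp.smul_apply, smul_eq_mul] at i1 i2
    have hpos : 0 < ‖Q - P‖ ^ 2 := by
      have := norm_pos_iff.2 (sub_ne_zero.2 hne.symm)
      positivity
    rw [norm_sq_plane] at hpos
    simp only [PiLp.sub_apply] at hpos
    have e : ((Q 0 - P 0) ^ 2 + (Q 1 - P 1) ^ 2) * (t - 1 / 2) = 0 := by
      linear_combination i2 - i1 + 1 / 2 * hPQ
    obtain rfl : t = 1 / 2 := by
      have := (mul_eq_zero.1 e).resolve_left hpos.ne'
      linarith
    have hm : (1 - 1 / 2 : ℝ) • P + (1 / 2 : ℝ) • Q = midpoint ℝ P Q := by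
      rw [midpoint_eq_smul_add]
      apply plane_ext <;>
        simp only [PiLp.add_apply, PiLp.smul_apply, smul_eq_mul, invOf_eq_inv] <;> ring
    rw [hm] at hs ⊢
    exact ⟨rfl, by simpa [EuclideanGeometry.mem_sphere] using hs⟩
  · rintro ⟨rfl, hm⟩
    have hin : ∀ x : Plane, x = P ∨ x = Q → inner ℝ (x - midpoint ℝ P Q) (midpoint ℝ P Q) = 0 := by
      rintro x (rfl | rfl) <;> rw [midpoint_eq_smul_add, inner_plane] <;> simp
      · linear_combination (1 / 4 : ℝ) * hPQ
      · linear_combination (-1 / 4 : ℝ) * hPQ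
    refine ⟨midpoint_mem_segment P Q, by simpa [EuclideanGeometry.mem_sphere] using hm,
      AffineMap.lineMap_mem_affineSpan_pair .., ?_⟩
    refine affineSpan_pair_le_of_mem_of_mem ?_ ?_ <;>
      rw [EuclideanGeometry.Sphere.mem_orthRadius_iff_inner_left]
    · simpa using hin P (Or.inl rfl)
    · simpa using hin Q (Or.inr rfl)

/-- The midpoint of `P Q` lies on some side `k`. There the nonnegative orientations of `P` and `Q`
average to zero, so both vanish, and the line of side `k` contains no vertices but its two ends. -/
lemma ConvexCycle.isSide_iff {n : ℕ} {v : ℕ → Plane} (h : ConvexCycle n v)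
    (hext : (polygon n v).extremePoints ℝ = v '' Set.Iio n) {P Q : Plane} :
    IsSide (polygon n v) P Q ↔
      ∃ k < n, (P = v k ∧ Q = v (k + 1)) ∨ (P = v (k + 1) ∧ Q = v k) := by
  have hE : ∀ k ≤ n, v k ∈ (polygon n v).extremePoints ℝ := fun k hk => by
    rw [hext, ← h.apply_mod hk]
    exact ⟨_, Nat.mod_lt _ h.pos_n, rfl⟩
  have hF : ∀ k < n, segment ℝ (v k) (v (k + 1)) ⊆ frontier (polygon n v) := fun k hk => by
    rw [h.frontier_polygon]
    exact Set.subset_biUnion_of_mem (u := fun k => segment ℝ (v k) (v (k + 1)))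
      (Finset.mem_coe.2 (Finset.mem_range.2 hk))
  constructor
  · rintro ⟨hP, hQ, hne, hseg⟩
    have hm := hseg (midpoint_mem_segment P Q)
    rw [h.frontier_polygon] at hm
    simp only [Set.mem_iUnion, Finset.mem_range, exists_prop] at hm
    obtain ⟨k, hk, hmk⟩ := hm
    have h0 := ConvexCycle.orient_eq_zero_of_mem_segment hmk
    have e : orient (v k) (v (k + 1)) (midpoint ℝ P Q) =
        (orient (v k) (v (k + 1)) P + orient (v k) (v (k + 1)) Q) / 2 := by
      rw [midpoint_eq_smul_add]; simp [orient]; ring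
    have p1 := h.orient_nonneg_of_mem hP.1 hk
    have p2 := h.orient_nonneg_of_mem hQ.1 hk
    have key : ∀ X ∈ (polygon n v).extremePoints ℝ, orient (v k) (v (k + 1)) X = 0 →
        X = v k ∨ X = v (k + 1) := by
      intro X hX hz
      rw [hext] at hX
      obtain ⟨j, hj, rfl⟩ := hX
      by_contra! hcon
      have := h.orient_side_pos hk hj (fun e => hcon.1 (by rw [e]))
        (fun e => hcon.2 (by rw [e, h.apply_mod hk]))
      linarith
    have kP := key P hP (by linarith)
    have kQ := key Q hQ (by linarith)
    refine ⟨k, hk, ?_⟩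
    rcases kP with rfl | rfl <;> rcases kQ with rfl | rfl
    · exact absurd rfl hne
    · exact Or.inl ⟨rfl, rfl⟩
    · exact Or.inr ⟨rfl, rfl⟩
    · exact absurd rfl hne
  · rintro ⟨k, hk, ⟨rfl, rfl⟩ | ⟨rfl, rfl⟩⟩
    · exact ⟨hE k hk.le, hE _ hk, (h.apply_succ_ne hk).symm, hF k hk⟩
    · exact ⟨hE _ hk, hE k hk.le, h.apply_succ_ne hk, by rw [segment_symm]; exact hF k hk⟩

/-- A polygon inscribed in the outer circle, with angles `η k` at the origin between a vertex and
the midpoint of the next side. -/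
structure IsInscribed (b : ℝ) (n : ℕ) (θ η : ℕ → ℝ) : Prop where
  cycle : ConvexCycle n fun k => pt b (θ k)
  ext : (polygon n fun k => pt b (θ k)).extremePoints ℝ = (fun k => pt b (θ k)) '' Set.Iio n
  eta_eq : ∀ k, η k = (θ (k + 1) - θ k) / 2
  pos : ∀ k < n, 0 < η k
  lt : ∀ k < n, η k < Real.pi / 2

namespace IsInscribed

variable {a b : ℝ} {n : ℕ} {θ η : ℕ → ℝ} (h : IsInscribed b n θ η)

include h

lemma norm_midpoint (hb : 0 < b) {k : ℕ} (hk : k < n) :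
    ‖midpoint ℝ (pt b (θ k)) (pt b (θ (k + 1)))‖ = b * Real.cos (η k) := by
  rw [midpoint_pt, ← h.eta_eq, norm_pt]
  exact mul_nonneg hb.le (Real.cos_nonneg_of_mem_Icc ⟨by linarith [h.pos k hk, Real.pi_pos],
    (h.lt k hk).le⟩)

lemma angle_midpoint (hb : 0 < b) {k : ℕ} (hk : k < n) :
    InnerProductGeometry.angle (pt b (θ k)) (midpoint ℝ (pt b (θ k)) (pt b (θ (k + 1)))) = η k ∧
    InnerProductGeometry.angle (pt b (θ (k + 1))) (midpoint ℝ (pt b (θ (k + 1))) (pt b (θ k))) =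
      η k := by
  have hc : 0 < Real.cos (η k) :=
    Real.cos_pos_of_mem_Ioo ⟨by linarith [h.pos k hk, Real.pi_pos], h.lt k hk⟩
  have hη := h.eta_eq k
  have hπ : η k ≤ Real.pi := by linarith [h.lt k hk, Real.pi_pos]
  rw [midpoint_comm (R := ℝ) (pt b (θ (k + 1))), InnerProductGeometry.angle,
    InnerProductGeometry.angle, h.norm_midpoint hb hk, norm_pt hb.le, norm_pt hb.le, midpoint_pt,
    ← hη, inner_pt, inner_pt, show (θ k + θ (k + 1)) / 2 - θ k = η k by rw [hη]; ring,
    show (θ k + θ (k + 1)) / 2 - θ (k + 1) = -η k by rw [hη]; ring, Real.cos_neg,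
    mul_div_cancel_left₀ _ (by positivity), Real.arccos_cos (h.pos k hk).le hπ]
  exact ⟨rfl, rfl⟩

lemma touchesAt_side (ha : 0 < a) (hab : a < b) {k : ℕ} (hk : k < n) {T : Plane} :
    TouchesAt a (pt b (θ k)) (pt b (θ (k + 1))) T ↔
      T = midpoint ℝ (pt b (θ k)) (pt b (θ (k + 1))) ∧ η k = xi0 a b := by
  have hb := ha.trans hab
  have hxi := xi0_lt ha hab
  rw [touchesAt_iff (by rw [norm_pt hb.le, norm_pt hb.le]) (h.cycle.apply_succ_ne hk).symm,
    h.norm_midpoint hb hk]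
  refine and_congr_right fun _ => ⟨fun he => ?_, fun he => ?_⟩
  · refine Real.injOn_cos ⟨(h.pos k hk).le, by linarith [h.lt k hk, Real.pi_pos]⟩
      ⟨(xi0_pos ha hab).le, by linarith [Real.pi_pos]⟩ ?_
    rw [cos_xi0 ha hab, eq_div_iff hb.ne']; linarith
  · rw [he, cos_xi0 ha hab]; field_simp

lemma exists_touchesAt_iff (ha : 0 < a) (hab : a < b) {k : ℕ} (hk : k < n) :
    (∃ T, TouchesAt a (pt b (θ k)) (pt b (θ (k + 1))) T) ↔ η k = xi0 a b := by
  simp only [h.touchesAt_side ha hab hk, exists_eq_left]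

lemma isChordSide_iff (ha : 0 < a) (hab : a < b) (hle : ∀ k < n, η k ≤ xi0 a b) {P Q : Plane} :
    IsChordSide a b (polygon n fun k => pt b (θ k)) P Q ↔
      ∃ k < n, η k < xi0 a b ∧ ((P = pt b (θ k) ∧ Q = pt b (θ (k + 1))) ∨
        (P = pt b (θ (k + 1)) ∧ Q = pt b (θ k))) := by
  have hb := ha.trans hab
  have hsymm : ∀ P Q : Plane, (∃ T, TouchesAt a Q P T) ↔ ∃ T, TouchesAt a P Q T := fun P Q =>
    ⟨fun ⟨T, hT⟩ => ⟨T, touchesAt_symm hT⟩, fun ⟨T, hT⟩ => ⟨T, touchesAt_symm hT⟩⟩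
  rw [IsChordSide, h.cycle.isSide_iff h.ext]
  constructor
  · rintro ⟨⟨k, hk, hPQ⟩, -, -, hT⟩
    refine ⟨k, hk, lt_of_le_of_ne (hle k hk) fun he => hT ?_, hPQ⟩
    have := (h.exists_touchesAt_iff ha hab hk).2 he
    rcases hPQ with ⟨rfl, rfl⟩ | ⟨rfl, rfl⟩
    · exact this
    · exact (hsymm _ _).1 this
  · rintro ⟨k, hk, hlt, hPQ⟩
    have := mt (h.exists_touchesAt_iff ha hab hk).1 hlt.ne
    refine ⟨⟨k, hk, hPQ⟩, ?_⟩
    rcases hPQ with ⟨rfl, rfl⟩ | ⟨rfl, rfl⟩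
    · exact ⟨norm_pt hb.le _, norm_pt hb.le _, this⟩
    · exact ⟨norm_pt hb.le _, norm_pt hb.le _, mt (hsymm _ _).2 this⟩

lemma chordAngles_eq (ha : 0 < a) (hab : a < b) (hle : ∀ k < n, η k ≤ xi0 a b) :
    chordAngles a b (polygon n fun k => pt b (θ k)) = {x | ∃ k < n, η k < xi0 a b ∧ x = η k} := by
  have hb := ha.trans hab
  ext x
  simp only [chordAngles, Set.mem_ofPred_eq, h.isChordSide_iff ha hab hle]
  constructor
  · rintro ⟨P, Q, ⟨k, hk, hlt, ⟨rfl, rfl⟩ | ⟨rfl, rfl⟩⟩, rfl⟩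
    · exact ⟨k, hk, hlt, (h.angle_midpoint hb hk).1⟩
    · exact ⟨k, hk, hlt, (h.angle_midpoint hb hk).2⟩
  · rintro ⟨k, hk, hlt, rfl⟩
    exact ⟨_, _, ⟨k, hk, hlt, Or.inl ⟨rfl, rfl⟩⟩, (h.angle_midpoint hb hk).1.symm⟩

open Classical in
lemma numChordAngles_eq (ha : 0 < a) (hab : a < b) (hle : ∀ k < n, η k ≤ xi0 a b) :
    numChordAngles a b (polygon n fun k => pt b (θ k)) = (smallIdx n η (xi0 a b)).card := by
  have : chordSides a b (polygon n fun k => pt b (θ k)) =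
      (fun k => segment ℝ (pt b (θ k)) (pt b (θ (k + 1)))) '' (smallIdx n η (xi0 a b) : Set ℕ) := by
    ext s
    simp only [chordSides, Set.mem_ofPred_eq, h.isChordSide_iff ha hab hle, smallIdx,
      Finset.coe_filter, Finset.mem_range, Set.mem_image]
    constructor
    · rintro ⟨P, Q, ⟨k, hk, hlt, ⟨rfl, rfl⟩ | ⟨rfl, rfl⟩⟩, rfl⟩
      · exact ⟨k, ⟨hk, hlt⟩, rfl⟩
      · exact ⟨k, ⟨hk, hlt⟩, segment_symm ..⟩
    · rintro ⟨k, ⟨hk, hlt⟩, rfl⟩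
      exact ⟨_, _, ⟨k, hk, hlt, Or.inl ⟨rfl, rfl⟩⟩, rfl⟩
  rw [numChordAngles, this, Set.InjOn.ncard_image, Set.ncard_coe_finset]
  -- Distinct indices give distinct segments, since no side lies on the line of another.
  intro j hj k hk hjk
  obtain ⟨hj, -⟩ : j < n ∧ _ := by simpa [smallIdx] using hj
  obtain ⟨hk, -⟩ : k < n ∧ _ := by simpa [smallIdx] using hk
  by_contra hne
  simp only at hjk
  have h1 := left_mem_segment ℝ (pt b (θ k)) (pt b (θ (k + 1)))
  have h2 := right_mem_segment ℝ (pt b (θ k)) (pt b (θ (k + 1)))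
  rw [← hjk] at h1 h2
  have e1 := ConvexCycle.orient_eq_zero_of_mem_segment h1
  have e2 := ConvexCycle.orient_eq_zero_of_mem_segment h2
  rcases h.cycle.orient_side_pos_or hj hk hne with hp | hp <;> linarith

open Classical in
lemma numTangentChordAngles_eq (ha : 0 < a) (hab : a < b) :
    numTangentChordAngles a b (polygon n fun k => pt b (θ k)) =
      (tangentIdx n η (xi0 a b)).card := by
  have hb := ha.trans hab
  let mid : ℕ → Plane := fun k => midpoint ℝ (pt b (θ k)) (pt b (θ (k + 1)))
  -- The Boolean chooses the end of the tangent side; the two halves of each side cancel the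
  -- division by two in `numTangentChordAngles`.
  let F : ℕ × Bool → Set Plane := fun i =>
    segment ℝ (if i.2 then pt b (θ i.1) else pt b (θ (i.1 + 1))) (mid i.1)
  have hset : tangentHalfChords a b (polygon n fun k => pt b (θ k)) =
      F '' ((tangentIdx n η (xi0 a b) ×ˢ (Finset.univ : Finset Bool) : Finset (ℕ × Bool)) :
        Set (ℕ × Bool)) := by
    ext s
    simp only [tangentHalfChords, Set.mem_ofPred_eq, h.cycle.isSide_iff h.ext, Set.mem_image,
      Finset.mem_coe, Finset.mem_product, Finset.mem_univ, and_true, tangentIdx,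
      Finset.mem_filter, Finset.mem_range]
    constructor
    · rintro ⟨P, Q, T, ⟨k, hk, ⟨rfl, rfl⟩ | ⟨rfl, rfl⟩⟩, -, hT, rfl⟩
      · obtain ⟨rfl, he⟩ := (h.touchesAt_side ha hab hk).1 hT
        exact ⟨(k, true), ⟨hk, he⟩, rfl⟩
      · obtain ⟨rfl, he⟩ := (h.touchesAt_side ha hab hk).1 (touchesAt_symm hT)
        exact ⟨(k, false), ⟨hk, he⟩, rfl⟩
    · rintro ⟨⟨k, s⟩, ⟨hk, he⟩, rfl⟩
      have hT := (h.touchesAt_side ha hab hk).2 ⟨rfl, he⟩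
      cases s
      · exact ⟨_, _, _, ⟨k, hk, Or.inr ⟨rfl, rfl⟩⟩, norm_pt hb.le _, touchesAt_symm hT, rfl⟩
      · exact ⟨_, _, _, ⟨k, hk, Or.inl ⟨rfl, rfl⟩⟩, norm_pt hb.le _, hT, rfl⟩
  have hinj : Set.InjOn F ((tangentIdx n η (xi0 a b) ×ˢ (Finset.univ : Finset Bool) :
      Finset (ℕ × Bool)) : Set (ℕ × Bool)) := by
    rintro ⟨k, s⟩ hks ⟨j, t⟩ hjt hF
    have hk : k < n := by
      have := (Finset.mem_product.1 hks).1
      exact Finset.mem_range.1 (Finset.mem_filter.1 this).1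
    have hj : j < n := by
      have := (Finset.mem_product.1 hjt).1
      exact Finset.mem_range.1 (Finset.mem_filter.1 this).1
    by_cases hkj : k = j
    · subst hkj
      by_cases hst : s = t
      · rw [hst]
      exfalso
      have hne := h.cycle.apply_succ_ne hk
      have hF' : segment ℝ (pt b (θ k)) (mid k) = segment ℝ (pt b (θ (k + 1))) (mid k) := by
        cases s <;> cases t
        · exact absurd rfl hst
        · exact hF.symm
        · exact hF
        · exact absurd rfl hst
      have hmem := left_mem_segment ℝ (pt b (θ k)) (mid k)
      rw [hF'] at hmem
      obtain ⟨x, y, hx, -, hxy, he⟩ := hmem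
      apply hne
      simp only [mid, midpoint_eq_smul_add] at he
      have g0 := congrArg (fun z : Plane => z 0) he
      have g1 := congrArg (fun z : Plane => z 1) he
      obtain rfl : y = 1 - x := by linarith
      have hpos : (0 : ℝ) < 1 + x := by linarith
      simp only [PiLp.add_apply, PiLp.smul_apply, smul_eq_mul, invOf_eq_inv] at g0 g1
      refine plane_ext (mul_left_cancel₀ hpos.ne' ?_) (mul_left_cancel₀ hpos.ne' ?_) <;> linarith
    -- Equal halves of different sides would put the midpoint of side `k` on side `j`, and then both
    -- ends of side `k` on the line of side `j`.
    · exfalso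
      have hend : (if t then pt b (θ j) else pt b (θ (j + 1))) ∈
          segment ℝ (pt b (θ j)) (pt b (θ (j + 1))) := by
        cases t
        · exact right_mem_segment ..
        · exact left_mem_segment ..
      have hsub : F (j, t) ⊆ segment ℝ (pt b (θ j)) (pt b (θ (j + 1))) :=
        (convex_segment _ _).segment_subset hend (midpoint_mem_segment _ _)
      have hm : mid k ∈ F (k, s) := right_mem_segment ..
      rw [hF] at hm
      have e0 := ConvexCycle.orient_eq_zero_of_mem_segment (hsub hm)
      have e : orient (pt b (θ j)) (pt b (θ (j + 1))) (mid k) =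
          (orient (pt b (θ j)) (pt b (θ (j + 1))) (pt b (θ k)) +
            orient (pt b (θ j)) (pt b (θ (j + 1))) (pt b (θ (k + 1)))) / 2 := by
        simp only [mid, midpoint_eq_smul_add]; simp [orient]; ring
      have p1 := h.cycle.orient_nonneg_of_mem (h.cycle.mem_polygon hk.le) hj
      have p2 := h.cycle.orient_nonneg_of_mem (h.cycle.mem_polygon hk) hj
      rcases h.cycle.orient_side_pos_or hj hk (Ne.symm hkj) with hp | hp <;> linarith
  rw [numTangentChordAngles, hset, hinj.ncard_image, Set.ncard_coe_finset,
    Finset.card_product]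
  simp

end IsInscribed

/-! ### Reduction to angles and conclusion -/

/-- Optimal polygons are inscribed in the outer circle, and their angles form a minimal family. -/
lemma exists_inscribed {a b lam : ℝ} (ha : 0 < a) (hab : a < b) (hlam0 : 0 < lam)
    (hlam : lam ≤ 1 / b) {Ω : Set Plane} (hpoly : IsConvexPolygon Ω) (hopt : IsOptimal a b lam Ω) :
    ∃ (n : ℕ) (θ η : ℕ → ℝ), IsInscribed b n θ η ∧ IsMinimalFamily a b lam n η ∧
      Ω = polygon n fun k => pt b (θ k) := by
  have hb := ha.trans hab
  obtain ⟨n, r, θ, hcyc, rfl, hext, hr, hrn, hθn, hθ⟩ := exists_cycle ha hpoly hopt.1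
  have hrb := norm_vertex_eq ha hab hlam0 hlam hcyc hopt hr hrn hθn hθ
  have himg : (fun k => pt (r k) (θ k)) '' Set.Iio n = (fun k => pt b (θ k)) '' Set.Iio n :=
    Set.image_congr fun k hk => by rw [hrb k (le_of_lt hk)]
  have hpol : (polygon n fun k => pt (r k) (θ k)) = polygon n fun k => pt b (θ k) := by
    rw [polygon, polygon, himg]
  have hcyc' : ConvexCycle n fun k => pt b (θ k) :=
    { three_le := hcyc.three_le
      closed := by simp only [hθn, pt_add_two_pi]
      pos := fun i j k hij hjk hk => by
        have := hcyc.pos i j k hij hjk hk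
        simpa only [hrb i (by omega), hrb j (by omega), hrb k hk.le] using this }
  rw [himg, hpol] at hext
  rw [hpol] at hopt ⊢
  have hpi := Real.pi_pos
  have hins : IsInscribed b n θ fun k => (θ (k + 1) - θ k) / 2 :=
    { cycle := hcyc'
      ext := hext
      eta_eq := fun k => rfl
      pos := fun k hk => by linarith [hθ k hk]
      lt := fun k hk => by linarith [hθ k hk] }
  refine ⟨n, θ, _, hins, ?_, rfl⟩
  have hsum : ∑ k ∈ Finset.range n, (θ (k + 1) - θ k) / 2 = Real.pi := by
    rw [← Finset.sum_div, Finset.sum_range_sub, hθn]; ring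
  refine ⟨hins.pos, fun k hk => ?_, hsum, fun ζ h0 h1 hζ => ?_⟩
  · have h1 := (hcyc'.closedBall_subset_iff ha.le).1 hopt.1.2.1 k hk
    have hθk := hθ k hk
    rw [norm_chord hb.le hθk.1.le (by linarith), cross_pt,
      show θ (k + 1) - θ k = 2 * ((θ (k + 1) - θ k) / 2) by ring, Real.sin_two_mul,
      mul_div_cancel_left₀ _ two_ne_zero] at h1
    have hs : 0 < Real.sin ((θ (k + 1) - θ k) / 2) :=
      Real.sin_pos_of_pos_of_lt_pi (by linarith) (by linarith)
    rw [le_xi0_iff ha hab (by linarith) (by linarith)]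
    refine le_of_mul_le_mul_left ?_ (mul_pos hb hs)
    linarith
  · obtain ⟨K, hK, hJ⟩ := exists_admissible_of_family lam ha hab (Finset.range n) (η := ζ)
      (fun k hk => h0 k (Finset.mem_range.1 hk)) (fun k hk => h1 k (Finset.mem_range.1 hk)) hζ
    have hle := hopt.2 K hK
    rw [hJ, hcyc'.J_polygon] at hle
    refine le_trans (le_of_eq ?_) hle
    refine Finset.sum_congr rfl fun k hk => ?_
    have hθk := hθ k (Finset.mem_range.1 hk)
    rw [chordJ_term hb.le hθk.1.le (by linarith)]

end RingProblem

theorem proposition3p5 (a b lam : ℝ) (ha : 0 < a) (hab : a < b)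
    (hlam : 1 / (2 * b) < lam) (hlam' : lam ≤ 1 / b)
    (Ω : Set RingProblem.Plane) (hpoly : RingProblem.IsConvexPolygon Ω)
    (hopt : RingProblem.IsOptimal a b lam Ω)
    (p : ℝ) (hp : p = RingProblem.numTangentChordAngles a b Ω)
    (q : ℕ) (hq : q = RingProblem.numChordAngles a b Ω)
    (ξ₀ x₀ x₁ : ℝ) (hξ₀ : ξ₀ = RingProblem.xi0 a b)
    (hx₀ : x₀ = RingProblem.x0 b lam) (hx₁ : x₁ = RingProblem.x1 b lam) :
    -- the first bounds; the lower one fails by one exactly if all sides are tangent chords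
    (p * ξ₀ ≠ Real.pi → (RingProblem.p0 a b : ℝ) + 1 - p ≤ q) ∧
    (p * ξ₀ = Real.pi → p = RingProblem.p0 a b ∧ q = 0) ∧
    (q : ℝ) ≤ Real.pi / x₀ - p * ξ₀ / x₀ + 1 ∧
    -- the bounds in the presence of two distinct chord angles; the radicand is non-negative
    ((∃ x ∈ RingProblem.chordAngles a b Ω, ∃ y ∈ RingProblem.chordAngles a b Ω, x ≠ y) →
      0 ≤ (Real.pi - p * ξ₀) ^ 2 - 9 / 2 * x₁ ∧
      (Real.pi - p * ξ₀ + Real.sqrt ((Real.pi - p * ξ₀) ^ 2 - 9 / 2 * x₁)) / (2 * x₁) + 1 ≤ q ∧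
      (q : ℝ) ≤ Real.pi / x₁ - p * ξ₀ / x₁ + 1) := by
  classical
  have hb := ha.trans hab
  have hlam0 : 0 < lam := lt_trans (by positivity) hlam
  have hμ : 1 / 2 < lam * b := by
    rw [div_lt_iff₀ (by positivity)] at hlam; linarith
  have hμ1 : lam * b ≤ 1 := (le_div_iff₀ hb).1 hlam'
  obtain ⟨n, θ, η, hins, hmin, rfl⟩ :=
    RingProblem.exists_inscribed ha hab hlam0 hlam' hpoly hopt
  rw [hins.numTangentChordAngles_eq ha hab] at hp
  rw [hins.numChordAngles_eq ha hab hmin.le] at hq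
  have hξpos := RingProblem.xi0_pos ha hab
  have hx0pos := RingProblem.x0_pos hμ
  have hsum := hmin.sum_smallIdx
  have hcard := hmin.card_smallIdx_le hb hμ
  have hpi := Real.pi_pos
  have hmem : ∀ k ∈ RingProblem.smallIdx n η (RingProblem.xi0 a b),
      k < n ∧ η k < RingProblem.xi0 a b := fun k hk => by simpa [RingProblem.smallIdx] using hk
  rw [← hξ₀] at hξpos hsum hcard hmem hp hq
  rw [← hx₀] at hx0pos hcard
  rw [← hq] at hcard
  rw [← hp] at hsum
  rw [hsum] at hcard
  refine ⟨fun hne => ?_, fun he => ?_, ?_, ?_⟩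
  -- Without free angles the tangent ones would fill `π`. A free angle makes `π < (p + q) ξ₀`
  -- strict, and this strictness gives the `+ 1` after taking the integer part.
  · have hQ : (RingProblem.smallIdx n η ξ₀).Nonempty := by
      rw [Finset.nonempty_iff_ne_empty]
      intro hQ
      rw [hQ, Finset.sum_empty] at hsum
      exact hne (by linarith)
    have hlt : ∑ k ∈ RingProblem.smallIdx n η ξ₀, η k < q * ξ₀ := by
      have := Finset.sum_lt_sum_of_nonempty hQ (g := fun _ => ξ₀) fun k hk => (hmem k hk).2
      rwa [Finset.sum_const, nsmul_eq_mul, ← hq] at this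
    have h1 : Real.pi / ξ₀ < ((RingProblem.tangentIdx n η ξ₀).card + q : ℕ) := by
      rw [div_lt_iff₀ hξpos]
      push_cast
      rw [← hp]
      linarith
    have h2 := (Nat.floor_lt (by positivity)).2 h1
    have h3 : ((RingProblem.p0 a b + 1 : ℕ) : ℝ) ≤
        ((RingProblem.tangentIdx n η ξ₀).card + q : ℕ) := by
      rw [RingProblem.p0, ← hξ₀]; exact_mod_cast h2
    push_cast at h3
    rw [← hp] at h3
    linarith
  · constructor
    · rw [RingProblem.p0, ← hξ₀, ← he, mul_div_cancel_right₀ _ hξpos.ne', hp, Nat.floor_natCast]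
    · rw [hq, Finset.card_eq_zero]
      by_contra hQ
      have := Finset.sum_pos (fun k hk => hmin.pos k (hmem k hk).1)
        (Finset.nonempty_iff_ne_empty.2 hQ)
      linarith
  · have := (le_div_iff₀ hx0pos).2 hcard
    rw [sub_div] at this
    linarith
  · rintro ⟨x, hx, y, hy, hxy⟩
    rw [hins.chordAngles_eq ha hab hmin.le] at hx hy
    obtain ⟨i, hi, hi', rfl⟩ := hx
    obtain ⟨j, hj, hj', rfl⟩ := hy
    have key : ∃ i j, i < n ∧ j < n ∧ η i < RingProblem.xi0 a b ∧ η j < RingProblem.xi0 a b ∧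
        η i < η j := by
      rcases lt_or_gt_of_ne hxy with hlt | hlt
      · exact ⟨i, j, hi, hj, hi', hj', hlt⟩
      · exact ⟨j, i, hj, hi, hj', hi', hlt⟩
    obtain ⟨i, j, hi, hj, hi', hj', hij⟩ := key
    obtain ⟨hT, r1, r2, r3⟩ := hmin.distinct_bounds ha hab hμ hμ1 hi hj hi' hj' hij
    rw [← hξ₀] at hT r2 r3
    rw [← hq] at r2 r3
    rw [← hx₁] at r1 r2 r3
    have hp0 : p = 0 := by rw [hp, hT, Nat.cast_zero]
    -- `x₁ = 0` would mean `lam * b = 1 / 2`, which the strict lower bound on `lam` excludes.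
    have hx1pos : 0 < x₁ := by
      rw [hx₁]
      refine lt_of_le_of_ne (RingProblem.x1_nonneg b lam) fun h0 => ?_
      have := RingProblem.cos_x1 hμ hμ1
      rw [← h0, Real.cos_zero] at this
      have h2 : 1 / (lam * b) < 2 := (div_lt_iff₀ (by linarith)).2 (by linarith)
      linarith
    rw [hp0, zero_mul, sub_zero, zero_div, sub_zero]
    refine ⟨r1, r2, ?_⟩
    have := (le_div_iff₀ hx1pos).2 r3
    linarith
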